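/- Let $\mathfrak{A}=(Q,\Sigma_I\times\Sigma_O,q_\iota,\delta,\Omega)$ be a deterministic (max-)parity automaton with $n$ states, finite non-empty alphabets $\Sigma_I,\Sigma_O$, and coloring $\Omega\colon Q\to\mathbb{N}$; let $C=\Omega(Q)$ and $c=|C|$. Put $\delta_{\mathcal T}((q,e),(a,b))=(q',\max\{e,\Omega(q')\})$ with $q'=\delta(q,(a,b))$, and $\delta_{\mathcal P}(S,a)=\{\delta_{\mathcal T}(x,(a,b))\mid x\in S,\ b\in\Sigma_O\}$ for $S\subseteq Q\times C$, extended to finite words over $\Sigma_I$ as $\delta^*_{\mathcal P}$. For non-empty $D\subseteq Q\times C$ and $w\in\Sigma_I^*$ let $r^D_w\colon D\to 2^{Q\times C}$, $r^D_w(q,e)=\delta^*_{\mathcal P}(\{(q,\Omega(q))\},w)$, and for $k>0$ let $\mathfrak{R}=\{r^D_w\mid w\in\Sigma_I^k,\ \emptyset\ne D\subseteq Q\times C\}$. In the game $\mathcal{G}_k$, in each round $i\in\mathbb{N}$ Player $I$ picks $r_i\in\mathfrak{R}$ with $\mathrm{dom}(r_0)=\{(q_\iota,\Omega(q_\iota))\}$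 and $\mathrm{dom}(r_i)=r_{i-1}(q_{i-1},c_{i-1})$ for $i>0$, and then Player $O$ picks $(q_i,c_i)\in\mathrm{dom}(r_i)$; Player $O$ wins a play iff $\limsup_i c_i$ is even. As an arena-based parity game, $\mathcal{G}_k$ has the vertices $\{v_\iota\}\cup\mathfrak{R}\times(Q\times C)$ of Player $I$, with initial vertex $v_\iota$, and the vertices $\mathfrak{R}$ of Player $O$; its edges are $v_\iota\to r$ if $\mathrm{dom}(r)=\{(q_\iota,\Omega(q_\iota))\}$, $(r,x)\to r'$ if $x\in\mathrm{dom}(r)$ and $\mathrm{dom}(r')=r(x)$, and $r\to(r,x)$ if $x\in\mathrm{dom}(r)$; the vertex $(r,(q,e))$ has color $e$ and all other vertices have color $\min C$. Claim: there are a (deterministic) algorithm and a constant $d$ such that the following holds for all such $\mathfrak{A}$ and all $k$ with $0<k\le 2^{n^2c+1}$. Given $\mathfrak{A}$ and $k$ (numbers written in binary, transitions as a table; let $\ell$ be the length of this input), the algorithm halts within $2^{d\,n^d}\cdot \ell^{d}$ steps and outputs a parity game $G$, with vertices numbered $0,\dots,N-1$, that is isomorphic to the arena-based parity game $\mathcal{G}_k$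 described above, together with a player $p$. Moreover, $N\le 2^{d\,n^d}$; the player $p$ has a winning strategy in $G$ from its initial vertex and the other player has none; and $p$ is Player $O$ if and only if Player $O$ has a winning strategy in $\mathcal{G}_k$. (Steps are counted for first-order functional programs over binary trees with unit-cost pairing, projection and emptiness test, a model polynomially equivalent to Turing machines.) -/

import Mathlib

namespace DelayGame

/-! ### Automata and the parity condition -/

/-- The parity condition: the largest number occurring infinitely often in `u` exists and is even.
For a bounded sequence this says that the limes superior of `u` is even. -/
def ParityAccepting (u : ℕ → ℕ) : Prop :=
  ∃ m, Even m ∧ (∃ᶠ i in Filter.atTop, u i = m) ∧ ∀ᶠ i in Filter.atTop, u i ≤ m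

/-- Deterministic parity automata with states `Q` and letters `S`; the automata that serve as inputs
below have finite `Q` and `S`. -/
structure DPA (Q S : Type*) where
  init : Q
  step : Q → S → Q
  color : Q → ℕ

namespace DPA

/-- The set `C = Ω(Q)` of colors, as a type. -/
abbrev Col {Q S : Type*} (𝔄 : DPA Q S) : Type := Set.range 𝔄.color

/-- The number of colors of the automaton. -/
noncomputable def numColors {Q S : Type*} (𝔄 : DPA Q S) : ℕ := (Set.range 𝔄.color).ncard

/-- The color of a state, as an element of `C`. -/
def colorOf {Q S : Type*} (𝔄 : DPA Q S) (q : Q) : 𝔄.Col := ⟨𝔄.color q, q, rfl⟩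

/-- The pairs `Q × C`. -/
abbrev Pos {Q S : Type*} (𝔄 : DPA Q S) : Type _ := Q × 𝔄.Col

/-- The transition function keeping track of the maximal color seen. -/
noncomputable def stepT {Q S : Type*} (𝔄 : DPA Q S) (x : 𝔄.Pos) (l : S) : 𝔄.Pos :=
  (𝔄.step x.1 l, max x.2 (𝔄.colorOf (𝔄.step x.1 l)))

/-- Projection to the first component of the letters and power set construction. -/
def stepP {Q I O : Type*} (𝔄 : DPA Q (I × O)) (X : Set 𝔄.Pos) (a : I) : Set 𝔄.Pos :=
  {y | ∃ x ∈ X, ∃ b : O, y = 𝔄.stepT x (a, b)}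

/-- The extension of `stepP` to finite words. -/
def stepPStar {Q I O : Type*} (𝔄 : DPA Q (I × O)) (X : Set 𝔄.Pos) (w : List I) : Set 𝔄.Pos :=
  w.foldl 𝔄.stepP X

/-- Partial functions from `Q × C` to the power set of `Q × C`. -/
abbrev PartialFun {Q S : Type*} (𝔄 : DPA Q S) : Type _ := 𝔄.Pos → Option (Set 𝔄.Pos)

/-- The domain of a partial function. -/
def dom {Q S : Type*} {𝔄 : DPA Q S} (r : 𝔄.PartialFun) : Set 𝔄.Pos := {x | (r x).isSome}

open Classical in
/-- The partial function `r_w^D` with domain `D`. -/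
noncomputable def behavior {Q I O : Type*} (𝔄 : DPA Q (I × O)) (D : Set 𝔄.Pos) (w : List I) :
    𝔄.PartialFun :=
  fun x => if x ∈ D then some (𝔄.stepPStar {(x.1, 𝔄.colorOf x.1)} w) else none

/-- The set of all `r_w^D` with a word `w` of length `k` and a non-empty `D`. -/
def behaviors {Q I O : Type*} (𝔄 : DPA Q (I × O)) (k : ℕ) : Set 𝔄.PartialFun :=
  {r | ∃ w : List I, ∃ D : Set 𝔄.Pos, w.length = k ∧ D.Nonempty ∧ r = 𝔄.behavior D w}

/-! ### The abstract game `𝒢_k`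

A play is a sequence of rounds; round `i` consists of the function `(ρ i).1` picked by Player `I`
and the pair `(ρ i).2` picked by Player `O`. -/

/-- The sequences of moves that obey the rules of the game. -/
structure IsPlay {Q I O : Type*} (𝔄 : DPA Q (I × O)) (k : ℕ)
    (ρ : ℕ → 𝔄.behaviors k × 𝔄.Pos) : Prop where
  /-- The first move of Player `I`. -/
  start : dom (ρ 0).1.1 = {(𝔄.init, 𝔄.colorOf 𝔄.init)}
  /-- The other moves of Player `I`: the domain of the new function is `r (q, c)`. -/
  next : ∀ i, (ρ i).1.1 (ρ i).2 = some (dom (ρ (i + 1)).1.1)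
  /-- The moves of Player `O`. -/
  answer : ∀ i, (ρ i).2 ∈ dom (ρ i).1.1

/-- Player `O` wins `𝒢_k`: she has a strategy `σ`, mapping the list of the previous rounds and the
current function `r` to an element of the domain of `r`, such that every play consistent with `σ`
satisfies the parity condition. -/
def OWins {Q I O : Type*} (𝔄 : DPA Q (I × O)) (k : ℕ) : Prop :=
  ∃ σ : List (𝔄.behaviors k × 𝔄.Pos) → 𝔄.behaviors k → 𝔄.Pos,
    (∀ h r, σ h r ∈ dom r.1) ∧
    ∀ ρ : ℕ → 𝔄.behaviors k × 𝔄.Pos, 𝔄.IsPlay k ρ →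
      (∀ i, (ρ i).2 = σ ((List.range i).map ρ) (ρ i).1) →
      ParityAccepting fun i => ((ρ i).2.2 : ℕ)

end DPA

/-! ### Arena-based parity games -/

inductive Player
  | I
  | O

/-- A parity game on a directed graph with an initial vertex. -/
structure ParityGame (V : Type*) where
  owner : V → Player
  edge : V → V → Prop
  init : V
  color : V → ℕ

namespace ParityGame

/-- The condition for an infinite play to be won by a player: Player `O` wins if the largest color
seen infinitely often is even, Player `I` wins all other plays. -/
def WinCond {V : Type*} (G : ParityGame V) (ρ : ℕ → V) : Player → Prop
  | .O => ParityAccepting fun i => G.color (ρ i)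
  | .I => ¬ ParityAccepting fun i => G.color (ρ i)

/-- The first `m` moves of `ρ` form a path from the initial vertex that is consistent with the
strategy `f` of player `p`. A strategy maps the history (which ends in the current vertex) to
the next vertex. -/
def Consistent {V : Type*} (G : ParityGame V) (p : Player) (f : List V → V) (ρ : ℕ → V) (m : ℕ) :
    Prop :=
  ρ 0 = G.init ∧ ∀ i < m, G.edge (ρ i) (ρ (i + 1)) ∧
    (G.owner (ρ i) = p → ρ (i + 1) = f ((List.range (i + 1)).map ρ))

/-- Player `p` has a winning strategy from the initial vertex: the strategy always provides a
legal move (so `p` never gets stuck, while a finite play in which the opponent gets stuck is won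
by `p`), and all infinite consistent plays are won by `p`. -/
def Wins {V : Type*} (G : ParityGame V) (p : Player) : Prop :=
  ∃ f : List V → V,
    (∀ ρ m, G.Consistent p f ρ m → G.owner (ρ m) = p →
      G.edge (ρ m) (f ((List.range (m + 1)).map ρ))) ∧
    ∀ ρ, (∀ m, G.Consistent p f ρ m) → G.WinCond ρ p

/-- `e` is an isomorphism of parity games. -/
structure IsIso {V W : Type*} (G : ParityGame V) (H : ParityGame W) (e : V ≃ W) : Prop where
  owner : ∀ v, H.owner (e v) = G.owner v
  edge : ∀ v v', H.edge (e v) (e v') ↔ G.edge v v'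
  init : e G.init = H.init
  color : ∀ v, H.color (e v) = G.color v

end ParityGame

namespace DPA

/-- The vertices of the arena for `𝒢_k`: a fresh initial vertex, the pairs of a function and an
element of `Q × C` (both of Player `I`), and the functions (of Player `O`). -/
inductive Vertex {Q I O : Type*} (𝔄 : DPA Q (I × O)) (k : ℕ)
  | start : Vertex 𝔄 k
  | pair (r : 𝔄.behaviors k) (x : 𝔄.Pos) : Vertex 𝔄 k
  | fn (r : 𝔄.behaviors k) : Vertex 𝔄 k

/-- `𝒢_k` as an arena-based parity game. -/
noncomputable def arena {Q I O : Type*} (𝔄 : DPA Q (I × O)) (k : ℕ) :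
    ParityGame (𝔄.Vertex k) where
  owner
    | .fn _ => .O
    | _ => .I
  edge
    | .start, .fn r => dom r.1 = {(𝔄.init, 𝔄.colorOf 𝔄.init)}
    | .pair r x, .fn r' => r.1 x = some (dom r'.1)
    | .fn r, .pair r' x => r' = r ∧ x ∈ dom r.1
    | _, _ => False
  init := .start
  color
    | .pair _ x => x.2
    | _ => sInf (Set.range 𝔄.color)

end DPA

/-! ### The model of computation

Programs of a first-order functional language with unary functions on binary trees (pure Lisp),
evaluated call by value. The primitives are constructing a pair, projecting, and testing for the
empty tree; there are no arithmetic operations and there is no equality test. The cost of an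
evaluation is the number of rules applied, each of which moves a bounded number of pointers, so
running times agree with those of Turing machines up to a polynomial. -/

inductive Tree
  | nil
  | node (l r : Tree)

namespace Tree

/-- The size of a tree (its number of nodes, leaves included). -/
def size : Tree → ℕ
  | nil => 1
  | node l r => l.size + r.size + 1

/-- The left component; that of the empty tree is the empty tree. -/
def left : Tree → Tree
  | nil => nil
  | node l _ => l

/-- The right component; that of the empty tree is the empty tree. -/
def right : Tree → Tree
  | nil => nil
  | node _ r => r

end Tree

/-- The expressions: the argument of the function that is being evaluated, the empty tree, pairs
and projections, a conditional testing for a non-empty tree, and a call of function number `f`. -/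
inductive Expr
  | arg
  | nil
  | cons (e₁ e₂ : Expr)
  | left (e : Expr)
  | right (e : Expr)
  | ite (e e₁ e₂ : Expr)
  | call (f : ℕ) (e : Expr)

/-- A program is a finite list of function bodies; function number `0` is the main function. -/
abbrev Program := List Expr

/-- `Eval P x e y t`: if the argument of the current function is `x`, then `e` evaluates to `y`
in exactly `t` steps. There is no rule for calls of functions missing in the program. -/
inductive Eval (P : Program) : Tree → Expr → Tree → ℕ → Prop
  | arg (x : Tree) : Eval P x .arg x 1
  | nil (x : Tree) : Eval P x .nil .nil 1
  | cons {x y₁ y₂ : Tree} {e₁ e₂ : Expr} {t₁ t₂ : ℕ} :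
      Eval P x e₁ y₁ t₁ → Eval P x e₂ y₂ t₂ → Eval P x (.cons e₁ e₂) (.node y₁ y₂) (t₁ + t₂ + 1)
  | left {x y : Tree} {e : Expr} {t : ℕ} :
      Eval P x e y t → Eval P x (.left e) y.left (t + 1)
  | right {x y : Tree} {e : Expr} {t : ℕ} :
      Eval P x e y t → Eval P x (.right e) y.right (t + 1)
  | ite_true {x l r y : Tree} {e e₁ e₂ : Expr} {t t₁ : ℕ} :
      Eval P x e (.node l r) t → Eval P x e₁ y t₁ → Eval P x (.ite e e₁ e₂) y (t + t₁ + 1)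
  | ite_false {x y : Tree} {e e₁ e₂ : Expr} {t t₂ : ℕ} :
      Eval P x e .nil t → Eval P x e₂ y t₂ → Eval P x (.ite e e₁ e₂) y (t + t₂ + 1)
  | call {x y z : Tree} {f : ℕ} {e b : Expr} {t t' : ℕ} :
      Eval P x e y t → P[f]? = some b → Eval P y b z t' → Eval P x (.call f e) z (t + t' + 1)

/-- The program `P` halts on input `x` with output `y` after `t` steps. -/
def Program.Outputs (P : Program) (x y : Tree) (t : ℕ) : Prop :=
  ∃ b, P[0]? = some b ∧ Eval P x b y t

/-! ### Encodings of inputs and outputs -/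

def encodeBool : Bool → Tree
  | false => .nil
  | true => .node .nil .nil

def encodeList {α : Type*} (f : α → Tree) : List α → Tree
  | [] => .nil
  | a :: l => .node (f a) (encodeList f l)

/-- Numbers are written in binary, least significant bit first. -/
def encodeNat (m : ℕ) : Tree := encodeList encodeBool m.bits

/-- The encoding of an automaton: the initial state, the table of all transitions, and the list
of the colors of the states. -/
def encodeDPA {n s t : ℕ} (𝔄 : DPA (Fin n) (Fin s × Fin t)) : Tree :=
  .node (encodeNat 𝔄.init)
    (.node
      (encodeList (encodeList (encodeList encodeNat)) (List.ofFn fun q => List.ofFn fun a =>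
        List.ofFn fun b => ((𝔄.step q (a, b) : Fin n) : ℕ)))
      (encodeList encodeNat (List.ofFn 𝔄.color)))

/-- The encoding of an automaton together with a number. -/
def encodeInput {n s t : ℕ} (𝔄 : DPA (Fin n) (Fin s × Fin t)) (k : ℕ) : Tree :=
  .node (encodeDPA 𝔄) (encodeNat k)

def encodePlayer : Player → Tree
  | .I => encodeBool false
  | .O => encodeBool true

open Classical in
/-- The encoding of a parity game with vertices `0, …, N - 1`: the initial vertex, the owners,
the colors, and the adjacency matrix. -/
noncomputable def encodeGame {N : ℕ} (G : ParityGame (Fin N)) : Tree :=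
  .node (encodeNat G.init)
    (.node (encodeList encodePlayer (List.ofFn G.owner))
      (.node (encodeList encodeNat (List.ofFn G.color))
        (encodeList (encodeList encodeBool)
          (List.ofFn fun v => List.ofFn fun v' => decide (G.edge v v')))))

/-- The encoding of a parity game together with a player. -/
noncomputable def encodeOutput {N : ℕ} (G : ParityGame (Fin N)) (p : Player) : Tree :=
  .node (encodeGame G) (encodePlayer p)

end DelayGame

/-!
The class of a word `w` is determined by its domain and the function `q ↦ δ_𝒫^*({(q, Ω(q))}, w)`.
The functions for the words of length `k` arise from that of the empty word by appending letters,
`k` times in succession, and there are at most `2 ^ n ^ 3` of them. So the arena has at most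
`2 ^ (4 * n ^ 3)` vertices and can be listed explicitly. As at most `n` colors occur, the nested
fixed point that characterizes the winning region, with one level of nesting per color, can be
evaluated in time exponential in a power of `n`. It yields positional winning strategies for both
players on complementary sets of vertices, and these strategies carry over to `𝒢_k`.

Giving each input a weight that exceeds its length by a number exponential in a power of `n` turns
the required running time into polynomial time in the weight. The functions computable in this time
are closed under composition and, if the intermediate results have polynomial weight, under
recursion along lists.
-/

namespace DelayGame

/-! ### Computation in polynomial time -/

section Programs

/-- Renumbering of the called functions by `d`, which moves a program behind `d` other functions. -/
def Expr.shift (d : ℕ) : Expr → Expr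
  | .arg => .arg
  | .nil => .nil
  | .cons e₁ e₂ => .cons (e₁.shift d) (e₂.shift d)
  | .left e => .left (e.shift d)
  | .right e => .right (e.shift d)
  | .ite e e₁ e₂ => .ite (e.shift d) (e₁.shift d) (e₂.shift d)
  | .call f e => .call (f + d) (e.shift d)

lemma Eval.shift {P Q : Program} {d : ℕ}
    (hPQ : ∀ i b, P[i]? = some b → Q[i + d]? = some (b.shift d)) {x y : Tree} {e : Expr} {t : ℕ}
    (h : Eval P x e y t) : Eval Q x (e.shift d) y t := by
  induction h with
  | arg x => exact .arg x
  | nil x => exact .nil x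
  | cons _ _ ih₁ ih₂ => exact .cons ih₁ ih₂
  | left _ ih => exact .left ih
  | right _ ih => exact .right ih
  | ite_true _ _ ih ih₁ => exact .ite_true ih ih₁
  | ite_false _ _ ih ih₂ => exact .ite_false ih ih₂
  | call _ hb _ ih ih' => exact .call ih (hPQ _ _ hb) ih'

lemma Program.getElem?_append_map_shift (P₀ P P₁ : Program) {i : ℕ} {b : Expr}
    (h : P[i]? = some b) :
    (P₀ ++ P.map (Expr.shift P₀.length) ++ P₁)[i + P₀.length]? = some (b.shift P₀.length) := by
  have hi : i < P.length := (List.getElem?_eq_some_iff.1 h).1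
  rw [List.append_assoc, List.getElem?_append_right (Nat.le_add_left ..), Nat.add_sub_cancel,
    List.getElem?_append_left (by simpa using hi), List.getElem?_map, h, Option.map_some]

lemma exists_eval_const (x : Tree) : ∃ e t, ∀ (P : Program) (y : Tree), Eval P y e x t := by
  induction x with
  | nil => exact ⟨.nil, 1, fun _ y => .nil y⟩
  | node l r ihl ihr =>
    obtain ⟨e, t, h⟩ := ihl
    obtain ⟨e', t', h'⟩ := ihr
    exact ⟨.cons e e', _, fun P y => .cons (h P y) (h' P y)⟩

end Programs

/-- Types whose elements are represented by trees. Polynomial bounds refer to the weight of an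
argument, which may exceed the size of its representation: this is how time that is exponential
in a parameter of the input is expressed as polynomial time. -/
class TreeEncoding (α : Type*) where
  enc : α → Tree
  weight : α → ℕ
  size_enc_lt_weight : ∀ a, (enc a).size < weight a

open TreeEncoding

section Encodings

lemma Tree.size_pos (x : Tree) : 0 < x.size := by
  cases x <;> simp [Tree.size]

lemma two_le_weight {α : Type*} [TreeEncoding α] (a : α) : 2 ≤ weight a :=
  (Nat.succ_le_succ (enc a).size_pos).trans (size_enc_lt_weight a)

instance : TreeEncoding Unit := ⟨fun _ => .nil, fun _ => 2, fun _ => by simp [Tree.size]⟩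

instance : TreeEncoding Bool := ⟨encodeBool, fun b => (encodeBool b).size + 1, fun _ => by simp⟩

instance {α β : Type*} [TreeEncoding α] [TreeEncoding β] : TreeEncoding (α × β) where
  enc p := .node (enc p.1) (enc p.2)
  weight p := weight p.1 + weight p.2
  size_enc_lt_weight p := by
    have h₁ := size_enc_lt_weight p.1
    have h₂ := size_enc_lt_weight p.2
    simp only [Tree.size]
    omega

instance {α : Type*} [TreeEncoding α] : TreeEncoding (List α) where
  enc := encodeList enc
  weight l := 2 + (l.map weight).sum
  size_enc_lt_weight l := by
    induction l with
    | nil => simp [encodeList, Tree.size]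
    | cons a l ih =>
      have h := size_enc_lt_weight a
      simp only [encodeList, Tree.size, List.map_cons, List.sum_cons]
      omega

instance : TreeEncoding ℕ where
  enc := encodeNat
  weight m := weight m.bits
  size_enc_lt_weight m := size_enc_lt_weight m.bits

variable {α β : Type*} [TreeEncoding α] [TreeEncoding β]

@[simp] lemma enc_prod (a : α) (b : β) : enc (a, b) = .node (enc a) (enc b) := rfl

@[simp] lemma enc_nil : enc ([] : List α) = .nil := rfl

@[simp] lemma enc_cons (a : α) (l : List α) : enc (a :: l) = .node (enc a) (enc l) := rfl

lemma enc_bits (m : ℕ) : enc m.bits = enc m := rfl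

@[simp] lemma weight_unit (a : Unit) : weight a = 2 := rfl

@[simp] lemma weight_true : weight true = 4 := rfl

@[simp] lemma weight_false : weight false = 2 := rfl

lemma weight_bool_le (b : Bool) : weight b ≤ 4 := by cases b <;> decide

@[simp] lemma weight_prod (a : α) (b : β) : weight (a, b) = weight a + weight b := rfl

@[simp] lemma weight_nil : weight ([] : List α) = 2 := rfl

@[simp] lemma weight_cons (a : α) (l : List α) : weight (a :: l) = weight a + weight l := by
  simp only [weight, List.map_cons, List.sum_cons]
  omega

lemma weight_bits (m : ℕ) : weight m.bits = weight m := rfl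

lemma weight_append (l l' : List α) : weight (l ++ l') + 2 = weight l + weight l' := by
  induction l with
  | nil => simp [add_comm]
  | cons a l ih => simp only [List.cons_append, weight_cons]; omega

lemma weight_flatten_le (l : List (List α)) : weight l.flatten ≤ weight l := by
  induction l with
  | nil => simp
  | cons x l ih =>
    have := weight_append x l.flatten
    simp only [List.flatten_cons, weight_cons]
    omega

lemma length_lt_weight (l : List α) : l.length < weight l := by
  induction l with
  | nil => simp
  | cons a l ih =>
    have := two_le_weight a
    simp only [List.length_cons, weight_cons]
    omega

lemma weight_le_of_sublist {l l' : List α} (h : l.Sublist l') : weight l ≤ weight l' :=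
  Nat.add_le_add_left ((h.map weight).sum_le_sum fun _ _ => Nat.zero_le _) 2

lemma weight_eq_of_perm {l l' : List α} (h : l.Perm l') : weight l = weight l' :=
  congrArg (2 + ·) (h.map weight).sum_eq

lemma weight_le_of_mem {l : List α} {a : α} (h : a ∈ l) : weight a ≤ weight l := by
  have := weight_le_of_sublist (List.singleton_sublist.2 h)
  rw [weight_cons] at this
  omega

lemma weight_list_le {l : List α} {L M : ℕ} (hL : l.length ≤ L) (hM : ∀ a ∈ l, weight a ≤ M) :
    weight l ≤ 2 + L * M := by
  have hsum : (l.map weight).sum ≤ l.length * M := by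
    simpa using List.sum_le_card_nsmul (l.map weight) M (by simpa using hM)
  exact Nat.add_le_add_left (hsum.trans (Nat.mul_le_mul_right M hL)) 2

/-- Encodings whose weight is the size of the representation, up to the summand `1` that makes
weights larger than `1`. -/
class SizeWeighted (α : Type*) [TreeEncoding α] : Prop where
  weight_eq : ∀ a : α, weight a = (enc a).size + 1

instance : SizeWeighted Bool := ⟨fun _ => rfl⟩

instance [SizeWeighted α] [SizeWeighted β] : SizeWeighted (α × β) := ⟨fun ⟨a, b⟩ => by
  have ha := SizeWeighted.weight_eq a
  have hb := SizeWeighted.weight_eq b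
  simp only [weight_prod, enc_prod, Tree.size]
  omega⟩

instance [SizeWeighted α] : SizeWeighted (List α) := ⟨fun l => by
  induction l with
  | nil => rfl
  | cons a l ih =>
    have ha := SizeWeighted.weight_eq a
    simp only [weight_cons, enc_cons, Tree.size]
    omega⟩

instance : SizeWeighted ℕ := ⟨fun m => SizeWeighted.weight_eq m.bits⟩

/-- Encodings that represent different elements by different trees. -/
class InjectiveEncoding (α : Type*) [TreeEncoding α] : Prop where
  enc_injective : Function.Injective (enc : α → Tree)

instance : InjectiveEncoding Bool := ⟨by
  rintro (_ | _) (_ | _) h <;> first | rfl | cases h⟩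

instance [InjectiveEncoding α] [InjectiveEncoding β] : InjectiveEncoding (α × β) :=
  ⟨fun p q h => by
    simp only [enc, Tree.node.injEq] at h
    exact Prod.ext (InjectiveEncoding.enc_injective h.1) (InjectiveEncoding.enc_injective h.2)⟩

instance [InjectiveEncoding α] : InjectiveEncoding (List α) := ⟨fun l => by
  induction l with
  | nil => rintro (_ | _) h <;> first | rfl | cases h
  | cons a l ih =>
    rintro (_ | ⟨b, l'⟩) h
    · cases h
    · simp only [enc_cons, Tree.node.injEq] at h
      rw [InjectiveEncoding.enc_injective h.1, ih h.2]⟩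

lemma bits_injective : Function.Injective Nat.bits := fun m k h =>
  Nat.eq_of_testBit_eq fun i => by rw [Nat.testBit_eq_inth, Nat.testBit_eq_inth, h]

instance : InjectiveEncoding ℕ :=
  ⟨fun _ _ h => bits_injective (InjectiveEncoding.enc_injective h)⟩

end Encodings

section PolynomialTime

variable {α β γ : Type*} [TreeEncoding α] [TreeEncoding β] [TreeEncoding γ]

/-- Numbers that are bounded by a polynomial in the weight of the argument. As weights are at
least `2`, it is enough to consider monomials with coefficient `1`. -/
@[fun_prop] def PolyBounded (h : α → ℕ) : Prop := ∃ c, ∀ a, h a ≤ weight a ^ c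

lemma weight_pow_le_weight_pow (a : α) {c d : ℕ} (h : c ≤ d) : weight a ^ c ≤ weight a ^ d :=
  Nat.pow_le_pow_right (zero_lt_two.trans_le (two_le_weight a)) h

namespace PolyBounded

variable {h h' : α → ℕ}

lemma mono (hh' : PolyBounded h') (hle : ∀ a, h a ≤ h' a) : PolyBounded h :=
  let ⟨c, hc⟩ := hh'
  ⟨c, fun a => (hle a).trans (hc a)⟩

@[fun_prop] lemma const (m : ℕ) : PolyBounded fun _ : α => m :=
  ⟨m, fun a => (Nat.lt_pow_self (two_le_weight a)).le⟩

@[fun_prop] lemma weight_self : PolyBounded fun a : α => weight a :=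
  ⟨1, fun a => (pow_one (weight a)).ge⟩

@[fun_prop] lemma mul (hh : PolyBounded h) (hh' : PolyBounded h') :
    PolyBounded fun a => h a * h' a := by
  obtain ⟨c, hc⟩ := hh
  obtain ⟨c', hc'⟩ := hh'
  exact ⟨c + c', fun a => by rw [pow_add]; exact Nat.mul_le_mul (hc a) (hc' a)⟩

@[fun_prop] lemma add (hh : PolyBounded h) (hh' : PolyBounded h') :
    PolyBounded fun a => h a + h' a := by
  obtain ⟨c, hc⟩ := hh
  obtain ⟨c', hc'⟩ := hh'
  refine ⟨c + c' + 1, fun a => ?_⟩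
  calc h a + h' a ≤ weight a ^ (c + c') + weight a ^ (c + c') :=
        Nat.add_le_add ((hc a).trans (weight_pow_le_weight_pow a (Nat.le_add_right c c')))
          ((hc' a).trans (weight_pow_le_weight_pow a (Nat.le_add_left c' c)))
    _ = weight a ^ (c + c') * 2 := (Nat.mul_two _).symm
    _ ≤ weight a ^ (c + c') * weight a := Nat.mul_le_mul_left _ (two_le_weight a)
    _ = weight a ^ (c + c' + 1) := (pow_succ _ _).symm

@[fun_prop] lemma pow (hh : PolyBounded h) (m : ℕ) : PolyBounded fun a => h a ^ m := by
  obtain ⟨c, hc⟩ := hh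
  exact ⟨c * m, fun a => by rw [pow_mul]; exact Nat.pow_le_pow_left (hc a) m⟩

lemma exists_le_of_weight_le {T : β → ℕ} {V : α → ℕ} (hT : PolyBounded T) (hV : PolyBounded V) :
    ∃ K : α → ℕ, PolyBounded K ∧ ∀ a b, weight b ≤ V a → T b ≤ K a := by
  obtain ⟨c, hc⟩ := hT
  exact ⟨fun a => V a ^ c, hV.pow c, fun a b hb => (hc b).trans (Nat.pow_le_pow_left hb c)⟩

lemma comp_of_weight {T : β → ℕ} {f : α → β} (hT : PolyBounded T)
    (hf : PolyBounded fun a => weight (f a)) : PolyBounded fun a => T (f a) :=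
  let ⟨c, hc⟩ := hT
  (hf.pow c).mono fun a => hc (f a)

end PolyBounded

/-- The expression `e` of the program `P` computes `f` in time `T`. -/
def Computes (P : Program) (e : Expr) (T : α → ℕ) (f : α → β) : Prop :=
  ∀ a, ∃ t ≤ T a, Eval P (enc a) e (enc (f a)) t

/-- Functions that are computable in time polynomial in the weight of the argument. The bound on
the weight of the result, which need not follow from the running time, makes these functions
closed under composition. -/
@[fun_prop] structure PolyTime (f : α → β) : Prop where
  polyBounded : PolyBounded fun a => weight (f a)
  exists_computes : ∃ P e T, PolyBounded T ∧ Computes P e T f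

namespace PolyTime

lemma exists_extension {f : α → β} (hf : PolyTime f) (P₀ : Program) :
    ∃ P e T, P₀ <+: P ∧ PolyBounded T ∧ ∀ Q, P <+: Q → Computes Q e T f := by
  obtain ⟨P, e, T, hT, h⟩ := hf.exists_computes
  refine ⟨P₀ ++ P.map (Expr.shift P₀.length), e.shift P₀.length, T, List.prefix_append .., hT, ?_⟩
  rintro _ ⟨P₁, rfl⟩ a
  obtain ⟨t, ht, he⟩ := h a
  exact ⟨t, ht, he.shift fun i b => P₀.getElem?_append_map_shift P P₁⟩

lemma of_enc_eq {f : α → β} (henc : ∀ a, enc (f a) = enc a)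
    (hweight : ∀ a, weight (f a) ≤ weight a) : PolyTime f where
  polyBounded := PolyBounded.weight_self.mono hweight
  exists_computes := ⟨[], .arg, fun _ => 1, .const 1, fun a => ⟨1, le_rfl, henc a ▸ .arg _⟩⟩

@[fun_prop] lemma const (b : β) : PolyTime fun _ : α => b where
  polyBounded := .const _
  exists_computes :=
    let ⟨e, t, h⟩ := exists_eval_const (enc b)
    ⟨[], e, fun _ => t, .const t, fun _ => ⟨t, le_rfl, h _ _⟩⟩

@[fun_prop] lemma comp {g : β → γ} {f : α → β} (hg : PolyTime g) (hf : PolyTime f) :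
    PolyTime fun a => g (f a) where
  polyBounded := hg.polyBounded.comp_of_weight hf.polyBounded
  exists_computes := by
    obtain ⟨P₁, eg, Tg, -, hTg, heg⟩ := hg.exists_extension []
    obtain ⟨P₂, ef, Tf, hP, hTf, hef⟩ := hf.exists_extension P₁
    refine ⟨P₂ ++ [eg], .call P₂.length ef, fun a => Tf a + Tg (f a) + 1,
      (hTf.add (hTg.comp_of_weight hf.polyBounded)).add (.const 1), fun a => ?_⟩
    obtain ⟨t, ht, h⟩ := hef (P₂ ++ [eg]) (List.prefix_append ..) a
    obtain ⟨t', ht', h'⟩ := heg (P₂ ++ [eg]) (hP.trans (List.prefix_append ..)) (f a)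
    exact ⟨t + t' + 1, by dsimp only; omega, .call h (by simp) h'⟩

@[fun_prop] lemma prodMk {f : α → β} {g : α → γ} (hf : PolyTime f) (hg : PolyTime g) :
    PolyTime fun a => (f a, g a) where
  polyBounded := hf.polyBounded.add hg.polyBounded
  exists_computes := by
    obtain ⟨P₁, ef, Tf, -, hTf, hef⟩ := hf.exists_extension []
    obtain ⟨P₂, eg, Tg, hP, hTg, heg⟩ := hg.exists_extension P₁
    refine ⟨P₂, .cons ef eg, fun a => Tf a + Tg a + 1, by fun_prop, fun a => ?_⟩
    obtain ⟨t, ht, h⟩ := hef P₂ hP a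
    obtain ⟨t', ht', h'⟩ := heg P₂ List.prefix_rfl a
    exact ⟨t + t' + 1, by dsimp only; omega, .cons h h'⟩

@[fun_prop] lemma fst : PolyTime (Prod.fst : α × β → α) where
  polyBounded := PolyBounded.weight_self.mono fun _ => Nat.le_add_right _ _
  exists_computes := ⟨[], .left .arg, fun _ => 2, .const 2, fun _ => ⟨2, le_rfl, .left (.arg _)⟩⟩

@[fun_prop] lemma snd : PolyTime (Prod.snd : α × β → β) where
  polyBounded := PolyBounded.weight_self.mono fun _ => Nat.le_add_left _ _
  exists_computes := ⟨[], .right .arg, fun _ => 2, .const 2, fun _ => ⟨2, le_rfl, .right (.arg _)⟩⟩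

@[fun_prop] lemma cons {f : α → β} {l : α → List β} (hf : PolyTime f) (hl : PolyTime l) :
    PolyTime fun a => f a :: l a :=
  comp (g := fun p : β × List β => p.1 :: p.2)
    (.of_enc_eq (fun _ => rfl) fun p => (weight_cons p.1 p.2).le) (hf.prodMk hl)

@[fun_prop] lemma tail {l : α → List β} (hl : PolyTime l) : PolyTime fun a => (l a).tail :=
  comp (g := List.tail)
    { polyBounded := PolyBounded.weight_self.mono fun l =>
        weight_le_of_sublist (List.tail_sublist l)
      exists_computes := ⟨[], .right .arg, fun _ => 2, .const 2, fun l =>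
        ⟨2, le_rfl, by cases l <;> exact .right (.arg _)⟩⟩ } hl

@[fun_prop] lemma cond {b : α → Bool} {f g : α → β} (hb : PolyTime b) (hf : PolyTime f)
    (hg : PolyTime g) : PolyTime fun a => bif b a then f a else g a where
  polyBounded := (hf.polyBounded.add hg.polyBounded).mono fun a => by cases b a <;> simp
  exists_computes := by
    obtain ⟨P₁, eb, Tb, -, hTb, heb⟩ := hb.exists_extension []
    obtain ⟨P₂, ef, Tf, hP₁, hTf, hef⟩ := hf.exists_extension P₁
    obtain ⟨P₃, eg, Tg, hP₂, hTg, heg⟩ := hg.exists_extension P₂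
    refine ⟨P₃, .ite eb ef eg, fun a => Tb a + Tf a + Tg a + 1, by fun_prop, fun a => ?_⟩
    obtain ⟨t, ht, h⟩ := heb P₃ (hP₁.trans hP₂) a
    obtain ⟨t₁, ht₁, h₁⟩ := hef P₃ hP₂ a
    obtain ⟨t₂, ht₂, h₂⟩ := heg P₃ List.prefix_rfl a
    dsimp only
    cases hba : b a <;> rw [hba] at h
    · exact ⟨t + t₂ + 1, by omega, .ite_false h h₂⟩
    · exact ⟨t + t₁ + 1, by omega, .ite_true h h₁⟩

@[fun_prop] lemma and {f g : α → Bool} (hf : PolyTime f) (hg : PolyTime g) :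
    PolyTime fun a => f a && g a := by
  have hand : ∀ b c : Bool, (b && c) = bif b then c else false := by decide
  simp only [hand]
  fun_prop

@[fun_prop] lemma or {f g : α → Bool} (hf : PolyTime f) (hg : PolyTime g) :
    PolyTime fun a => f a || g a := by
  have hor : ∀ b c : Bool, (b || c) = bif b then true else c := by decide
  simp only [hor]
  fun_prop

@[fun_prop] lemma not {f : α → Bool} (hf : PolyTime f) : PolyTime fun a => !f a := by
  have hnot : ∀ b : Bool, (!b) = bif b then false else true := by decide
  simp only [hnot]
  fun_prop

@[fun_prop] lemma bits {f : α → ℕ} (hf : PolyTime f) : PolyTime fun a => (f a).bits :=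
  comp (g := Nat.bits) (.of_enc_eq enc_bits fun m => (weight_bits m).le) hf

lemma of_bits {f : α → ℕ} (hf : PolyTime fun a => (f a).bits) : PolyTime f where
  polyBounded := hf.polyBounded
  exists_computes := hf.exists_computes

end PolyTime

end PolynomialTime

section ListRecursion

variable {α β γ σ : Type*} [TreeEncoding α] [TreeEncoding β] [TreeEncoding γ] [TreeEncoding σ]

/-- An expression for recursion along a list, to be placed as function number `m + 3` of a program
behind functions for the base case, the parameter of the recursive call and the recursion step. Its
arguments have the form `(a, l, p)` with a list `l` and a parameter `p`. -/
def recBody (m : ℕ) : Expr :=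
  let parts : Expr := .cons (.left .arg) (.cons (.left (.left (.right .arg)))
    (.cons (.right (.left (.right .arg))) (.right (.right .arg))))
  .ite (.left (.right .arg))
    (.call (m + 2) (.cons parts (.call (m + 3) (.cons (.left .arg)
      (.cons (.right (.left (.right .arg))) (.call (m + 1) parts))))))
    (.call m (.cons (.left .arg) (.right (.right .arg))))

lemma exists_eval_recBody {Q : Program} {m : ℕ} {eB eH eG : Expr} {a : α} {R : List β → γ → σ}
    {next : β → List β → γ → γ} {S : List β → γ → Prop} {K : ℕ} (hm : Q[m]? = some eB)
    (hm₁ : Q[m + 1]? = some eH) (hm₂ : Q[m + 2]? = some eG) (hm₃ : Q[m + 3]? = some (recBody m))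
    (hB : ∀ p, S [] p → ∃ t ≤ K, Eval Q (enc (a, p)) eB (enc (R [] p)) t)
    (hH : ∀ x l p, S (x :: l) p →
      ∃ t ≤ K, Eval Q (enc (a, x, l, p)) eH (enc (next x l p)) t)
    (hG : ∀ x l p, S (x :: l) p →
      ∃ t ≤ K, Eval Q (enc ((a, x, l, p), R l (next x l p))) eG (enc (R (x :: l) p)) t)
    (hS : ∀ x l p, S (x :: l) p → S l (next x l p)) {l : List β} {p : γ} (hlp : S l p) :
    ∃ t ≤ (l.length + 1) * (3 * K + 50), Eval Q (enc (a, l, p)) (recBody m) (enc (R l p)) t := by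
  induction l generalizing p with
  | nil =>
    obtain ⟨t, ht, h⟩ := hB p hlp
    refine ⟨_, ?_, .ite_false (.left (.right (.arg _)))
      (.call (.cons (.left (.arg _)) (.right (.right (.arg _)))) hm h)⟩
    simp only [List.length_nil]
    omega
  | cons x l ih =>
    obtain ⟨t, ht, h⟩ := hH x l p hlp
    obtain ⟨t', ht', h'⟩ := ih (hS x l p hlp)
    obtain ⟨u, hu, h''⟩ := hG x l p hlp
    have hparts : Eval Q (enc (a, x :: l, p)) _ (enc (a, x, l, p)) _ :=
      .cons (.left (.arg _)) (.cons (.left (.left (.right (.arg _))))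
        (.cons (.right (.left (.right (.arg _)))) (.right (.right (.arg _)))))
    refine ⟨_, ?_, .ite_true (.left (.right (.arg _))) (.call (.cons hparts
      (.call (.cons (.left (.arg _)) (.cons (.right (.left (.right (.arg _))))
        (.call hparts hm₁ h))) hm₃ h')) hm₂ h'')⟩
    rw [List.length_cons, Nat.succ_mul]
    omega

namespace PolyTime

lemma exists_rec {R : α → List β → γ → σ} {base : α → γ → σ} {next : α → β → List β → γ → γ}
    {step : α → β → List β → γ → σ → σ} (hbase : PolyTime fun q : α × γ => base q.1 q.2)
    (hnext : PolyTime fun q : α × β × List β × γ => next q.1 q.2.1 q.2.2.1 q.2.2.2)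
    (hstep : PolyTime fun q : (α × β × List β × γ) × σ =>
      step q.1.1 q.1.2.1 q.1.2.2.1 q.1.2.2.2 q.2)
    (hnil : ∀ a p, R a [] p = base a p)
    (hcons : ∀ a x l p, R a (x :: l) p = step a x l p (R a l (next a x l p)))
    {S : α → List β → γ → Prop} (hS : ∀ a x l p, S a (x :: l) p → S a l (next a x l p))
    {W : α → ℕ} (hW : PolyBounded W)
    (hSW : ∀ a l p, S a l p → weight l ≤ W a ∧ weight p ≤ W a ∧ weight (R a l p) ≤ W a)
    (P₀ : Program) :
    ∃ (P : Program) (f : ℕ) (e : Expr) (K : α → ℕ), P₀ <+: P ∧ P[f]? = some e ∧ PolyBounded K ∧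
      ∀ a l p, S a l p → ∃ t ≤ (l.length + 1) * K a,
        Eval P (enc (a, l, p)) e (enc (R a l p)) t := by
  obtain ⟨P₁, eB, TB, hP₀, hTB, heB⟩ := hbase.exists_extension P₀
  obtain ⟨P₂, eH, TH, hP₁, hTH, heH⟩ := hnext.exists_extension P₁
  obtain ⟨P₃, eG, TG, hP₂, hTG, heG⟩ := hstep.exists_extension P₂
  have hV : PolyBounded fun a => weight a + 4 * W a := by fun_prop
  obtain ⟨KB, hKB, hTB⟩ := hTB.exists_le_of_weight_le hV
  obtain ⟨KH, hKH, hTH⟩ := hTH.exists_le_of_weight_le hV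
  obtain ⟨KG, hKG, hTG⟩ := hTG.exists_le_of_weight_le hV
  set P : Program := P₃ ++ [eB, eH, eG, recBody P₃.length]
  have hP₃ : P₃ <+: P := List.prefix_append ..
  refine ⟨P, P₃.length + 3, recBody P₃.length, fun a => 3 * (KB a + KH a + KG a) + 50,
    hP₀.trans (hP₁.trans (hP₂.trans hP₃)), by simp [P], by fun_prop,
    fun a l p hlp => exists_eval_recBody (m := P₃.length) (eB := eB) (eH := eH) (eG := eG)
      (next := next a) (S := S a) (by simp [P]) (by simp [P]) (by simp [P]) (by simp [P])
      (fun p hlp => ?_) (fun x l p hlp => ?_) (fun x l p hlp => ?_) (hS a) hlp⟩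
  · obtain ⟨t, ht, h⟩ := heB P (hP₁.trans (hP₂.trans hP₃)) (a, p)
    have hw := hSW a _ _ hlp
    have := hTB a (a, p) (by rw [weight_prod]; omega)
    exact ⟨t, by omega, hnil a p ▸ h⟩
  · obtain ⟨t, ht, h⟩ := heH P (hP₂.trans hP₃) (a, x, l, p)
    have hw := hSW a _ _ hlp
    rw [weight_cons] at hw
    have := hTH a (a, x, l, p) (by simp only [weight_prod]; omega)
    exact ⟨t, by omega, h⟩
  · obtain ⟨t, ht, h⟩ := heG P hP₃ ((a, x, l, p), R a l (next a x l p))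
    have hw := hSW a _ _ hlp
    have hw' := hSW a _ _ (hS a _ _ _ hlp)
    rw [weight_cons] at hw
    have := hTG a ((a, x, l, p), R a l (next a x l p)) (by simp only [weight_prod]; omega)
    exact ⟨t, by omega, hcons a x l p ▸ h⟩

lemma listRec {R : α → List β → γ → σ} {l₀ : α → List β} {p₀ : α → γ} {base : α → γ → σ}
    {next : α → β → List β → γ → γ} {step : α → β → List β → γ → σ → σ}
    (hl : PolyTime l₀) (hp : PolyTime p₀) (hbase : PolyTime fun q : α × γ => base q.1 q.2)
    (hnext : PolyTime fun q : α × β × List β × γ => next q.1 q.2.1 q.2.2.1 q.2.2.2)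
    (hstep : PolyTime fun q : (α × β × List β × γ) × σ =>
      step q.1.1 q.1.2.1 q.1.2.2.1 q.1.2.2.2 q.2)
    (hnil : ∀ a p, R a [] p = base a p)
    (hcons : ∀ a x l p, R a (x :: l) p = step a x l p (R a l (next a x l p)))
    (S : α → List β → γ → Prop) (hS₀ : ∀ a, S a (l₀ a) (p₀ a))
    (hS : ∀ a x l p, S a (x :: l) p → S a l (next a x l p)) {W : α → ℕ} (hW : PolyBounded W)
    (hSW : ∀ a l p, S a l p → weight l ≤ W a ∧ weight p ≤ W a ∧ weight (R a l p) ≤ W a) :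
    PolyTime fun a => R a (l₀ a) (p₀ a) where
  polyBounded := hW.mono fun a => (hSW a _ _ (hS₀ a)).2.2
  exists_computes := by
    obtain ⟨P₁, el, Tl, -, hTl, hel⟩ := hl.exists_extension []
    obtain ⟨P₂, ep, Tp, hP₁, hTp, hep⟩ := hp.exists_extension P₁
    obtain ⟨P, f, e, K, hP₂, hf, hK, he⟩ :=
      exists_rec hbase hnext hstep hnil hcons hS hW hSW P₂
    have hlength := hl.polyBounded
    refine ⟨P, .call f (.cons .arg (.cons el ep)),
      fun a => Tl a + Tp a + weight (l₀ a) * K a + 5, by fun_prop, fun a => ?_⟩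
    obtain ⟨t, ht, h⟩ := he a _ _ (hS₀ a)
    obtain ⟨t₁, ht₁, h₁⟩ := hel P (hP₁.trans hP₂) a
    obtain ⟨t₂, ht₂, h₂⟩ := hep P hP₂ a
    refine ⟨_, ?_, .call (.cons (.arg _) (.cons h₁ h₂)) hf h⟩
    have := Nat.mul_le_mul_right (K a) (length_lt_weight (l₀ a))
    rw [Nat.succ_eq_add_one] at this
    dsimp only
    omega

lemma foldr {l : α → List β} {z : α → σ} {g : α → β → σ → σ}
    (hg : PolyTime fun q : α × β × σ => g q.1 q.2.1 q.2.2) (hz : PolyTime z) (hl : PolyTime l)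
    {W : α → ℕ} (hW : PolyBounded W)
    (hgW : ∀ a l', l' <:+ l a → weight (l'.foldr (g a) (z a)) ≤ W a) :
    PolyTime fun a => (l a).foldr (g a) (z a) := by
  have hlW := hl.polyBounded
  refine listRec (R := fun a l (_ : Unit) => l.foldr (g a) (z a)) (p₀ := fun _ => ())
    (base := fun a _ => z a) (next := fun _ _ _ _ => ()) (step := fun a x _ _ => g a x)
    (W := fun a => W a + weight (l a) + 2) hl (by fun_prop) (by fun_prop) (by fun_prop)
    (hg.comp (f := fun q : (α × β × List β × Unit) × σ => (q.1.1, q.1.2.1, q.2)) (by fun_prop))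
    (fun _ _ => rfl) (fun _ _ _ _ => rfl) (fun a l' _ => l' <:+ l a)
    (fun a => List.suffix_rfl) (fun a x l' _ h => (List.suffix_cons x l').trans h) (by fun_prop)
    fun a l' p h => ?_
  have := hgW a l' h
  have := weight_le_of_sublist h.sublist
  exact ⟨by omega, by simp, by omega⟩

lemma foldl {l : α → List β} {z : α → σ} {g : α → σ → β → σ}
    (hg : PolyTime fun q : α × σ × β => g q.1 q.2.1 q.2.2) (hz : PolyTime z) (hl : PolyTime l)
    {W : α → ℕ} (hW : PolyBounded W)
    (hgW : ∀ a l', l' <+: l a → weight (l'.foldl (g a) (z a)) ≤ W a) :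
    PolyTime fun a => (l a).foldl (g a) (z a) := by
  refine listRec (R := fun a l p => l.foldl (g a) p) (p₀ := z)
    (base := fun _ p => p) (next := fun a x _ p => g a p x) (step := fun _ _ _ _ r => r)
    hl hz (by fun_prop)
    (hg.comp (f := fun q : α × β × List β × σ => (q.1, q.2.2.2, q.2.1)) (by fun_prop))
    (by fun_prop) (fun _ _ => rfl) (fun _ _ _ _ => rfl)
    (fun a l' p => ∃ l₁, l₁ ++ l' = l a ∧ p = l₁.foldl (g a) (z a))
    (fun a => ⟨[], rfl, rfl⟩) (fun a x l' p ⟨l₁, h, hp⟩ => ⟨l₁ ++ [x], by simp [h], by simp [hp]⟩)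
    (hW.add hl.polyBounded) ?_
  rintro a l' _ ⟨l₁, h, rfl⟩
  have := weight_le_of_sublist (h ▸ List.sublist_append_right l₁ l')
  have := hgW a l₁ ⟨l', h⟩
  have := hgW a (l₁ ++ l') (h ▸ List.prefix_rfl)
  rw [← List.foldl_append]
  exact ⟨by omega, by omega, by omega⟩

@[fun_prop] lemma map {l : α → List β} {g : α → β → σ}
    (hg : PolyTime fun q : α × β => g q.1 q.2) (hl : PolyTime l) :
    PolyTime fun a => (l a).map (g a) := by
  obtain ⟨W, hW, hgW⟩ :=
    hg.polyBounded.exists_le_of_weight_le (PolyBounded.weight_self.add hl.polyBounded)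
  have hlW := hl.polyBounded
  simp only [List.map_eq_foldr]
  refine foldr (g := fun a x r => g a x :: r) (W := fun a => 2 + weight (l a) * W a)
    (.cons (hg.comp (f := fun q : α × β × List σ => (q.1, q.2.1)) (by fun_prop)) (by fun_prop))
    (.const []) hl (by fun_prop) fun a l' hl' => ?_
  rw [← List.map_eq_foldr]
  refine weight_list_le ?_ (List.forall_mem_map.2 fun x hx => ?_)
  · rw [List.length_map]
    exact hl'.length_le.trans (length_lt_weight (l a)).le
  · exact hgW a (a, x) (Nat.add_le_add_left (weight_le_of_mem (hl'.subset hx)) _)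

@[fun_prop] lemma filter {l : α → List β} {g : α → β → Bool}
    (hg : PolyTime fun q : α × β => g q.1 q.2) (hl : PolyTime l) :
    PolyTime fun a => (l a).filter (g a) := by
  have hfoldr (a) (l' : List β) : l'.filter (g a) =
      l'.foldr (fun x r => bif g a x then x :: r else r) [] := by
    induction l' with
    | nil => rfl
    | cons x l' ih => cases h : g a x <;> simp [h, ih]
  simp only [hfoldr]
  refine foldr (g := fun a x r => bif g a x then x :: r else r)
    (.cond (hg.comp (f := fun q : α × β × List β => (q.1, q.2.1)) (by fun_prop))
      (by fun_prop) (by fun_prop)) (.const []) hl hl.polyBounded fun a l' hl' => ?_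
  rw [← hfoldr]
  exact weight_le_of_sublist (List.filter_sublist.trans hl'.sublist)

@[fun_prop] lemma append {l l' : α → List β} (hl : PolyTime l) (hl' : PolyTime l') :
    PolyTime fun a => l a ++ l' a := by
  simp only [← List.foldr_cons_eq_append']
  refine foldr (g := fun _ => List.cons) (by fun_prop) hl' hl
    (hl.polyBounded.add hl'.polyBounded) fun a l₁ h => ?_
  have := weight_append l₁ (l' a)
  have := weight_le_of_sublist h.sublist
  rw [List.foldr_cons_eq_append']
  omega

@[fun_prop] lemma flatten {l : α → List (List β)} (hl : PolyTime l) :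
    PolyTime fun a => (l a).flatten := by
  have hfoldr (l : List (List β)) : l.flatten = l.foldr (fun x r => x ++ r) [] := by
    induction l with
    | nil => rfl
    | cons x l ih => rw [List.flatten_cons, List.foldr_cons, ih]
  simp only [hfoldr]
  refine foldr (g := fun _ x r => x ++ r) (by fun_prop) (.const []) hl hl.polyBounded
    fun a l₁ h => ?_
  rw [← hfoldr]
  exact (weight_flatten_le l₁).trans (weight_le_of_sublist h.sublist)

@[fun_prop] lemma flatMap {l : α → List β} {g : α → β → List σ}
    (hg : PolyTime fun q : α × β => g q.1 q.2) (hl : PolyTime l) :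
    PolyTime fun a => (l a).flatMap (g a) := by
  simp only [List.flatMap_def]
  fun_prop

lemma foldr_bool {l : α → List β} {z : α → Bool} {g : α → β → Bool → Bool}
    (hg : PolyTime fun q : α × β × Bool => g q.1 q.2.1 q.2.2) (hz : PolyTime z)
    (hl : PolyTime l) : PolyTime fun a => (l a).foldr (g a) (z a) :=
  foldr hg hz hl (.const 4) fun _ _ _ => weight_bool_le _

@[fun_prop] lemma any {l : α → List β} {g : α → β → Bool}
    (hg : PolyTime fun q : α × β => g q.1 q.2) (hl : PolyTime l) :
    PolyTime fun a => (l a).any (g a) := by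
  have hfoldr (a) (l : List β) : l.any (g a) = l.foldr (fun x r => g a x || r) false := by
    induction l with
    | nil => rfl
    | cons x l ih => rw [List.any_cons, List.foldr_cons, ih]
  simp only [hfoldr]
  exact foldr_bool (.or (hg.comp (f := fun q : α × β × Bool => (q.1, q.2.1)) (by fun_prop))
    (by fun_prop)) (.const _) hl

@[fun_prop] lemma all {l : α → List β} {g : α → β → Bool}
    (hg : PolyTime fun q : α × β => g q.1 q.2) (hl : PolyTime l) :
    PolyTime fun a => (l a).all (g a) := by
  simp only [List.all_eq_not_any_not]
  fun_prop

@[fun_prop] lemma headD {l : α → List β} {d : α → β} (hl : PolyTime l) (hd : PolyTime d) :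
    PolyTime fun a => (l a).headD (d a) := by
  have hfoldr (l : List β) (d : β) : l.headD d = l.foldr (fun x _ => x) d := by cases l <;> rfl
  simp only [hfoldr]
  refine foldr (g := fun _ x _ => x) (by fun_prop) hd hl (hl.polyBounded.add hd.polyBounded)
    fun a l' h => ?_
  cases l' with
  | nil => exact Nat.le_add_left _ _
  | cons x l' => exact (weight_le_of_mem (h.subset List.mem_cons_self)).trans (Nat.le_add_right _ _)

end PolyTime

end ListRecursion

section EqualityTest

/-- A recursive equality test for the two components of the argument. -/
def eqExpr : Expr :=
  .ite (.left .arg)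
    (.ite (.right .arg)
      (.ite (.call 0 (.cons (.left (.left .arg)) (.left (.right .arg))))
        (.call 0 (.cons (.right (.left .arg)) (.right (.right .arg)))) .nil) .nil)
    (.ite (.right .arg) .nil (.cons .nil .nil))

open Classical in
lemma exists_eval_eqExpr_node {u₁ u₂ v₁ v₂ : Tree} {t₁ t₂ : ℕ}
    (h₁ : Eval [eqExpr] (.node u₁ v₁) eqExpr (encodeBool (decide (u₁ = v₁))) t₁)
    (h₂ : Eval [eqExpr] (.node u₂ v₂) eqExpr (encodeBool (decide (u₂ = v₂))) t₂) :
    ∃ t ≤ t₁ + t₂ + 25, Eval [eqExpr] (.node (.node u₁ u₂) (.node v₁ v₂)) eqExpr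
      (encodeBool (decide (Tree.node u₁ u₂ = .node v₁ v₂))) t := by
  set x : Tree := .node (.node u₁ u₂) (.node v₁ v₂)
  have hl : Eval [eqExpr] x (.left .arg) (.node u₁ u₂) 2 := .left (.arg _)
  have hr : Eval [eqExpr] x (.right .arg) (.node v₁ v₂) 2 := .right (.arg _)
  have hleft := Eval.call (.cons (.left hl) (.left hr)) (f := 0) rfl h₁
  have hright := Eval.call (.cons (.right hl) (.right hr)) (f := 0) rfl h₂
  simp only [Tree.node.injEq]
  by_cases h : u₁ = v₁
  · rw [decide_eq_true h] at hleft
    simp only [h, true_and]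
    exact ⟨_, by omega, .ite_true hl (.ite_true hr (.ite_true hleft hright))⟩
  · rw [decide_eq_false h] at hleft
    simp only [h, false_and, decide_false]
    exact ⟨_, by omega, .ite_true hl (.ite_true hr (.ite_false hleft (.nil _)))⟩

open Classical in
lemma exists_eval_eqExpr (u v : Tree) :
    ∃ t ≤ 30 * u.size, Eval [eqExpr] (.node u v) eqExpr (encodeBool (decide (u = v))) t := by
  induction u generalizing v with
  | nil =>
    have hl : Eval [eqExpr] (.node .nil v) (.left .arg) .nil 2 := .left (.arg _)
    have hr : Eval [eqExpr] (.node .nil v) (.right .arg) v 2 := .right (.arg _)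
    cases v with
    | nil =>
      rw [decide_eq_true rfl]
      exact ⟨_, by simp [Tree.size], .ite_false hl (.ite_false hr (.cons (.nil _) (.nil _)))⟩
    | node v₁ v₂ =>
      rw [decide_eq_false nofun]
      exact ⟨_, by simp [Tree.size], .ite_false hl (.ite_true hr (.nil _))⟩
  | node u₁ u₂ ih₁ ih₂ =>
    cases v with
    | nil =>
      rw [decide_eq_false nofun]
      exact ⟨7, by simp only [Tree.size]; omega, .ite_true (t := 2) (.left (.arg _))
        (.ite_false (t := 2) (.right (.arg _)) (.nil _))⟩
    | node v₁ v₂ =>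
      obtain ⟨t₁, ht₁, h₁⟩ := ih₁ v₁
      obtain ⟨t₂, ht₂, h₂⟩ := ih₂ v₂
      obtain ⟨t, ht, h⟩ := exists_eval_eqExpr_node h₁ h₂
      exact ⟨t, by simp only [Tree.size]; omega, h⟩

variable {α β : Type*} [TreeEncoding α] [TreeEncoding β]

open Classical in
@[fun_prop] lemma PolyTime.beq [InjectiveEncoding β] [BEq β] [LawfulBEq β] {f g : α → β}
    (hf : PolyTime f) (hg : PolyTime g) : PolyTime fun a => f a == g a := by
  refine comp (g := fun p : β × β => p.1 == p.2) ⟨(PolyBounded.const 4).mono fun _ =>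
    weight_bool_le _, [eqExpr], eqExpr, fun p => 30 * weight p, by fun_prop, fun p => ?_⟩
    (hf.prodMk hg)
  obtain ⟨t, ht, h⟩ := exists_eval_eqExpr (enc p.1) (enc p.2)
  have hsize : (enc p.1).size ≤ weight p :=
    (size_enc_lt_weight p.1).le.trans (Nat.le_add_right _ _)
  refine ⟨t, ht.trans (Nat.mul_le_mul_left _ hsize), ?_⟩
  have hbeq : (p.1 == p.2) = decide (enc p.1 = enc p.2) := by
    rw [Bool.eq_iff_iff, beq_iff_eq, decide_eq_true_iff, InjectiveEncoding.enc_injective.eq_iff]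
  dsimp only
  rwa [hbeq]

end EqualityTest

section BinaryNumbers

/-- The successor of a number in binary notation. -/
def succBits : List Bool → List Bool
  | [] => [true]
  | b :: l => bif b then false :: succBits l else true :: l

/-- Comparison of numbers in binary notation. The higher digits take precedence, so the lowest
digits only matter if the remaining ones agree. -/
def leBits : List Bool → List Bool → Bool
  | [], _ => true
  | b :: l, l' => bif l == l'.tail then (bif b then l'.headD false else true) else leBits l l'.tail

/-- The value of a number in binary notation, in unary notation. -/
def unaryBits (l : List Bool) : List Unit :=
  l.foldr (fun b r => bif b then () :: (r ++ r) else r ++ r) []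

lemma bits_eq_cons {m : ℕ} (h : m ≠ 0) : m.bits = m.bodd :: m.div2.bits := by
  conv_lhs => rw [← Nat.bit_bodd_div2 m]
  refine Nat.bits_append_bit _ _ fun h0 => ?_
  have := Nat.bodd_add_div2 m
  cases hb : m.bodd <;> simp_all

lemma bits_tail (m : ℕ) : m.bits.tail = m.div2.bits := by
  rcases eq_or_ne m 0 with rfl | h
  · simp
  · rw [bits_eq_cons h, List.tail_cons]

lemma bits_headD (m : ℕ) : m.bits.headD false = m.bodd := by
  rcases eq_or_ne m 0 with rfl | h
  · simp
  · rw [bits_eq_cons h, List.headD_cons]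

lemma div2_lt_self {m : ℕ} (h : m ≠ 0) : m.div2 < m := by
  rw [Nat.div2_val]
  omega

lemma bits_succ (m : ℕ) : (m + 1).bits = succBits m.bits := by
  induction m using Nat.strong_induction_on with
  | _ m ih =>
    rcases eq_or_ne m 0 with rfl | h
    · simp [succBits]
    rw [bits_eq_cons h, bits_eq_cons (Nat.succ_ne_zero m), succBits, Nat.bodd_succ, Nat.div2_succ]
    cases m.bodd
    · rfl
    · exact congrArg (false :: ·) (ih _ (div2_lt_self h))

lemma weight_succBits_le (l : List Bool) : weight (succBits l) ≤ weight l + 4 := by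
  induction l with
  | nil => simp [succBits]
  | cons b l ih =>
    cases b <;> simp only [succBits, cond_true, cond_false, weight_cons, weight_true, weight_false]
      <;> omega

lemma weight_succ_le (m : ℕ) : weight (m + 1) ≤ weight m + 4 := by
  rw [← weight_bits, bits_succ]
  exact weight_succBits_le m.bits

lemma weight_nat_le (m : ℕ) : weight m ≤ 4 * m + 2 := by
  induction m with
  | zero => simp [← weight_bits]
  | succ m ih =>
    have := weight_succ_le m
    omega

lemma decide_le_eq_leBits (m k : ℕ) : decide (m ≤ k) = leBits m.bits k.bits := by
  induction m using Nat.strong_induction_on generalizing k with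
  | _ m ih =>
    rcases eq_or_ne m 0 with rfl | h
    · simp [leBits]
    have hm := Nat.bodd_add_div2 m
    have hk := Nat.bodd_add_div2 k
    rw [bits_eq_cons h, leBits, bits_tail, bits_headD, ← ih _ (div2_lt_self h), Bool.eq_iff_iff,
      decide_eq_true_eq]
    rcases eq_or_ne m.div2 k.div2 with heq | hne
    · rw [heq, beq_self_eq_true, cond_true]
      cases hb : m.bodd <;> cases hb' : k.bodd <;> simp [hb, hb'] at hm hk ⊢ <;> omega
    · rw [beq_false_of_ne (bits_injective.ne hne), cond_false, decide_eq_true_eq]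
      cases hb : m.bodd <;> cases hb' : k.bodd <;> simp [hb, hb'] at hm hk <;> omega

lemma unaryBits_bits (m : ℕ) : unaryBits m.bits = List.replicate m () := by
  induction m using Nat.strong_induction_on with
  | _ m ih =>
    rcases eq_or_ne m 0 with rfl | h
    · simp [unaryBits]
    have hm := Nat.bodd_add_div2 m
    have ih := ih _ (div2_lt_self h)
    rw [bits_eq_cons h]
    simp only [unaryBits, List.foldr_cons] at ih ⊢
    rw [ih, List.eq_replicate_iff]
    cases hb : m.bodd <;> simp [hb] at hm ⊢ <;> omega

lemma length_unaryBits_le (l l' : List Bool) :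
    (unaryBits l').length ≤ (unaryBits (l ++ l')).length := by
  induction l with
  | nil => exact le_rfl
  | cons b l ih =>
    refine ih.trans ?_
    cases b <;> simp only [unaryBits, List.cons_append, List.foldr_cons, cond_true, cond_false,
      List.length_cons, List.length_append] <;> omega

namespace PolyTime

variable {α : Type*} [TreeEncoding α]

@[fun_prop] lemma succ {f : α → ℕ} (hf : PolyTime f) : PolyTime fun a => f a + 1 := by
  refine .of_bits ?_
  simp only [bits_succ]
  refine listRec (R := fun _ l (_ : Unit) => succBits l) (p₀ := fun _ => ())
    (base := fun _ _ => [true]) (next := fun _ _ _ _ => ())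
    (step := fun _ b l _ r => bif b then false :: r else true :: l) hf.bits (by fun_prop)
    (by fun_prop) (by fun_prop) (by fun_prop) (fun _ _ => rfl) (fun _ _ _ _ => rfl)
    (fun a l' _ => l' <:+ (f a).bits) (fun a => List.suffix_rfl)
    (fun a x l' _ h => (List.suffix_cons x l').trans h) (hf.bits.polyBounded.add (.const 6))
    fun a l' p h => ?_
  have := weight_le_of_sublist h.sublist
  have := weight_succBits_le l'
  exact ⟨by omega, by simp, by omega⟩

@[fun_prop] lemma decide_le {f g : α → ℕ} (hf : PolyTime f) (hg : PolyTime g) :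
    PolyTime fun a => decide (f a ≤ g a) := by
  simp only [decide_le_eq_leBits]
  refine listRec (R := fun _ l p => leBits l p) (base := fun _ _ => true)
    (next := fun _ _ _ p => p.tail)
    (step := fun _ b l p r => bif l == p.tail then (bif b then p.headD false else true) else r)
    hf.bits hg.bits (by fun_prop) (by fun_prop) (by fun_prop) (fun _ _ => rfl)
    (fun _ _ _ _ => rfl) (fun a l' p => l' <:+ (f a).bits ∧ p <:+ (g a).bits)
    (fun a => ⟨List.suffix_rfl, List.suffix_rfl⟩)
    (fun a x l' p h => ⟨(List.suffix_cons x l').trans h.1, (List.tail_suffix p).trans h.2⟩)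
    ((hf.bits.polyBounded.add hg.bits.polyBounded).add (.const 4)) fun a l' p h => ?_
  have := weight_le_of_sublist h.1.sublist
  have := weight_le_of_sublist h.2.sublist
  have := weight_bool_le (leBits l' p)
  exact ⟨by omega, by omega, by omega⟩

@[fun_prop] lemma max {f g : α → ℕ} (hf : PolyTime f) (hg : PolyTime g) :
    PolyTime fun a => max (f a) (g a) := by
  simp only [max_def, ← Bool.cond_decide]
  fun_prop

@[fun_prop] lemma bodd {f : α → ℕ} (hf : PolyTime f) : PolyTime fun a => (f a).bodd := by
  simp only [← bits_headD]
  fun_prop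

lemma replicate {k : α → ℕ} (hk : PolyTime k) (hkbd : PolyBounded k) :
    PolyTime fun a => List.replicate (k a) () := by
  simp only [← unaryBits_bits]
  refine foldr (g := fun _ b r => bif b then () :: (r ++ r) else r ++ r)
    (W := fun a => 2 + k a * 2) (by fun_prop) (.const []) hk.bits (by fun_prop)
    fun a l' ⟨l, h⟩ => weight_list_le ?_ fun _ _ => le_rfl
  have := length_unaryBits_le l l'
  rwa [h, unaryBits_bits, List.length_replicate] at this

end PolyTime

end BinaryNumbers

section ListFunctions

variable {α β : Type*}

lemma dedup_eq_foldr [DecidableEq β] (l : List β) :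
    l.dedup = l.foldr (fun x r => bif r.any (x == ·) then r else x :: r) [] := by
  induction l with
  | nil => rfl
  | cons x l ih =>
    have hany : l.dedup.any (x == ·) = decide (x ∈ l) := by
      rw [Bool.eq_iff_iff, List.any_eq_true]
      simp
    rw [List.foldr_cons, ← ih, hany]
    by_cases h : x ∈ l <;> simp [h]

lemma foldl_eq_append_zipIdx (l : List β) (r : List (β × ℕ)) (m : ℕ) :
    l.foldl (fun (p : List (β × ℕ) × ℕ) x => (p.1 ++ [(x, p.2)], p.2 + 1)) (r, m) =
      (r ++ l.zipIdx m, m + l.length) := by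
  induction l generalizing r m with
  | nil => simp
  | cons x l ih => simp [ih, List.zipIdx_cons, add_right_comm, add_assoc]

lemma sublists'_eq_foldr (l : List β) :
    l.sublists' = l.foldr (fun x r => r ++ r.map (x :: ·)) [[]] := by
  induction l with
  | nil => rfl
  | cons x l ih => rw [List.sublists'_cons, ih, List.foldr_cons]

variable [TreeEncoding α] [TreeEncoding β]

lemma weight_zipIdx_le (l : List β) :
    weight l.zipIdx ≤ 2 + weight l * (weight l + (4 * weight l + 2)) := by
  have hlength := length_lt_weight l
  refine weight_list_le (by rw [List.length_zipIdx]; omega) fun ⟨x, i⟩ hx => ?_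
  obtain ⟨-, hi, hxi⟩ := List.mem_zipIdx hx
  have hx : weight x ≤ weight l := weight_le_of_mem (hxi ▸ List.getElem_mem _)
  have := weight_nat_le i
  rw [weight_prod]
  omega

namespace PolyTime

@[fun_prop] lemma dedup [InjectiveEncoding β] [DecidableEq β] {l : α → List β}
    (hl : PolyTime l) : PolyTime fun a => (l a).dedup := by
  simp only [dedup_eq_foldr]
  refine foldr (g := fun _ x r => bif r.any (x == ·) then r else x :: r) (by fun_prop)
    (.const []) hl hl.polyBounded fun a l' h => ?_
  rw [← dedup_eq_foldr]
  exact weight_le_of_sublist ((List.dedup_sublist l').trans h.sublist)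

lemma orderedInsert {x : α → β} {l : α → List β} {r : β → β → Prop} [DecidableRel r]
    (hr : PolyTime fun p : β × β => decide (r p.1 p.2)) (hx : PolyTime x) (hl : PolyTime l) :
    PolyTime fun a => (l a).orderedInsert r (x a) := by
  refine listRec (R := fun _ l p => l.orderedInsert r p) (base := fun _ p => [p])
    (next := fun _ _ _ p => p)
    (step := fun _ y l p s => bif decide (r p y) then p :: y :: l else y :: s) hl hx (by fun_prop)
    (by fun_prop) (.cond (hr.comp (f := fun q : (α × β × List β × β) × List β =>
      (q.1.2.2.2, q.1.2.1)) (by fun_prop)) (by fun_prop) (by fun_prop)) (fun _ _ => rfl)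
    (fun _ y l' p => by rw [List.orderedInsert_cons, Bool.cond_decide])
    (fun a l' p => l' <:+ l a ∧ p = x a) (fun a => ⟨List.suffix_rfl, rfl⟩)
    (fun a y l' p h => ⟨(List.suffix_cons y l').trans h.1, h.2⟩)
    (hl.polyBounded.add hx.polyBounded) fun a l' p ⟨h, hp⟩ => ?_
  have := weight_le_of_sublist h.sublist
  rw [weight_eq_of_perm (List.perm_orderedInsert r p l'), weight_cons, hp]
  exact ⟨by omega, by omega, by omega⟩

@[fun_prop] lemma insertionSort {l : α → List β} {r : β → β → Prop} [DecidableRel r]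
    (hr : PolyTime fun p : β × β => decide (r p.1 p.2)) (hl : PolyTime l) :
    PolyTime fun a => (l a).insertionSort r :=
  foldr (g := fun _ => List.orderedInsert r) (orderedInsert hr (by fun_prop) (by fun_prop))
    (.const []) hl hl.polyBounded fun _ l' h =>
      (weight_eq_of_perm (List.perm_insertionSort r l')).trans_le (weight_le_of_sublist h.sublist)

@[fun_prop] lemma zipIdx {l : α → List β} (hl : PolyTime l) :
    PolyTime fun a => (l a).zipIdx := by
  have hfoldl (l : List β) : l.zipIdx =
      (l.foldl (fun (p : List (β × ℕ) × ℕ) x => (p.1 ++ [(x, p.2)], p.2 + 1)) ([], 0)).1 := by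
    rw [foldl_eq_append_zipIdx, List.nil_append]
  have hlW := hl.polyBounded
  simp only [hfoldl]
  refine .comp .fst (foldl (g := fun _ (p : List (β × ℕ) × ℕ) x => (p.1 ++ [(x, p.2)], p.2 + 1))
    (W := fun a => 2 + weight (l a) * (weight (l a) + (4 * weight (l a) + 2)) +
      (4 * weight (l a) + 2)) (by fun_prop) (.const _) hl (by fun_prop) fun a l' h => ?_)
  rw [foldl_eq_append_zipIdx, List.nil_append, zero_add, weight_prod]
  have hl' := weight_le_of_sublist h.sublist
  have hlength := length_lt_weight l'
  refine Nat.add_le_add ((weight_zipIdx_le l').trans ?_) ((weight_nat_le _).trans (by omega))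
  gcongr

lemma sublists' {l : α → List β} (hl : PolyTime l) (hlbd : PolyBounded fun a => 2 ^ (l a).length) :
    PolyTime fun a => (l a).sublists' := by
  have hlW := hl.polyBounded
  simp only [sublists'_eq_foldr]
  refine foldr (g := fun _ x (r : List (List β)) => r ++ r.map (x :: ·))
    (W := fun a => 2 + 2 ^ (l a).length * weight (l a)) (by fun_prop) (.const _) hl (by fun_prop)
    fun a l' h => ?_
  rw [← sublists'_eq_foldr]
  refine weight_list_le ?_ fun s hs =>
    weight_le_of_sublist ((List.mem_sublists'.1 hs).trans h.sublist)
  rw [List.length_sublists']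
  exact Nat.pow_le_pow_right zero_lt_two h.length_le

end PolyTime

end ListFunctions

/-! ### Solving parity games by nested fixed points -/

lemma exists_frequently_eq_and_eventually_le {ι : Type*} {l : Filter ι} [l.NeBot] {u : ι → ℕ}
    (h : ∃ b, ∀ᶠ i in l, u i ≤ b) : ∃ m, (∃ᶠ i in l, u i = m) ∧ ∀ᶠ i in l, u i ≤ m := by
  classical
  refine ⟨Nat.find h, fun hne => ?_, Nat.find_spec h⟩
  have hlt : ∀ᶠ i in l, u i < Nat.find h := by
    filter_upwards [hne, Nat.find_spec h] with i hi hi' using lt_of_le_of_ne hi' hi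
  obtain ⟨i, hi⟩ := hlt.exists
  exact Nat.find_min h (m := Nat.find h - 1) (by omega)
    (hlt.mono fun i hi => Nat.le_sub_one_of_lt hi)

lemma exists_seq_eq_map_range {α : Type*} (F : List α → α) :
    ∃ ρ : ℕ → α, ∀ i, ρ i = F ((List.range i).map ρ) := by
  set H : ℕ → List α := fun i => Nat.rec [] (fun _ l => l ++ [F l]) i
  refine ⟨fun i => F (H i), fun i => congrArg F ?_⟩
  induction i with
  | zero => rfl
  | succ i ih => rw [List.range_succ, List.map_append, ← ih]; rfl

lemma map_iterate_univ_subset {V : Type*} {f : Set V → Set V} (hf : Monotone f) (j : ℕ) :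
    f (f^[j] Set.univ) ⊆ f^[j] Set.univ := by
  rw [← Function.iterate_succ_apply' f]
  exact hf.antitone_iterate_of_map_le (Set.subset_univ _) j.le_succ

lemma iterate_univ_stable_or_ncard_le {V : Type*} [Finite V] {f : Set V → Set V}
    (hf : Monotone f) (j : ℕ) :
    f (f^[j] Set.univ) = f^[j] Set.univ ∨ (f^[j] Set.univ).ncard + j ≤ Nat.card V := by
  induction j with
  | zero => exact .inr (by simp [Set.ncard_univ])
  | succ j ih =>
    rw [Function.iterate_succ_apply']
    by_cases heq : f (f^[j] Set.univ) = f^[j] Set.univ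
    · exact .inl (congrArg f heq)
    · have hcard := Set.ncard_lt_ncard ((map_iterate_univ_subset hf j).ssubset_of_ne heq)
      have := ih.resolve_left heq
      exact .inr (by omega)

lemma map_iterate_univ_eq {V : Type*} [Finite V] {f : Set V → Set V} (hf : Monotone f) {N : ℕ}
    (hN : Nat.card V ≤ N) : f (f^[N] Set.univ) = f^[N] Set.univ := by
  refine (iterate_univ_stable_or_ncard_le hf N).elim id fun h => ?_
  have hempty : f^[N] Set.univ = ∅ := by
    rw [← Set.ncard_eq_zero (Set.toFinite _)]
    omega
  exact (map_iterate_univ_subset hf N).antisymm (hempty ▸ Set.empty_subset _)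

lemma update_le_update {V : Type*} {Z Z' : ℕ → Set V} (h : Z ≤ Z') (c : ℕ) {X Y : Set V}
    (hX : X ⊆ Y) : Function.update Z c X ≤ Function.update Z' c Y :=
  update_le_update_iff.2 ⟨hX, fun d _ => h d⟩

/-- The opponent of a player. -/
def Player.other : Player → Player
  | .I => .O
  | .O => .I

namespace ParityGame

/-- The colors that are good for player `p`. -/
def Good (p : Player) (c : ℕ) : Prop := Even c ↔ p = .O

lemma good_other (p : Player) (c : ℕ) : Good p.other c ↔ ¬ Good p c := by
  cases p <;> simp [Good, Player.other]

variable {V : Type*} (G : ParityGame V)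

/-- The controllable predecessor: the vertices from which player `p` can force the next vertex
to be in `X`. -/
def pre (p : Player) (X : Set V) : Set V :=
  {v | (G.owner v = p → ∃ u, G.edge v u ∧ u ∈ X) ∧ (G.owner v ≠ p → ∀ u, G.edge v u → u ∈ X)}

/-- The nested fixed point for the colors in a list, outermost color first: a greatest fixed point
for the colors that are good for `p`, a least one for the others, each approximated by `N`
iterations. Vertices of a color `c` not in the list have to be left for `Z c`. -/
noncomputable def solve (p : Player) (N : ℕ) : List ℕ → (ℕ → Set V) → Set V
  | [], Z => {v | v ∈ G.pre p (Z (G.color v))}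
  | c :: cs, Z => (fun X => solve p N cs (Function.update Z c X))^[N] {_v | Good p c}

variable {G}

lemma pre_mono {p : Player} {X Y : Set V} (h : X ⊆ Y) : G.pre p X ⊆ G.pre p Y :=
  fun _ hv => ⟨fun ho => (hv.1 ho).imp fun _ hu => ⟨hu.1, h hu.2⟩,
    fun ho u hu => h (hv.2 ho u hu)⟩

lemma solve_mono {p : Player} {N : ℕ} {cs : List ℕ} : Monotone (G.solve p N cs) := by
  induction cs with
  | nil => exact fun Z Z' h v hv => pre_mono (h _) hv
  | cons c cs ih =>
    intro Z Z' h
    exact Monotone.iterate_le_of_le (fun _ _ hX => ih (update_le_update le_rfl c hX))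
      (fun _ => ih (update_le_update h c subset_rfl)) N _

lemma solve_congr {p : Player} {N : ℕ} {cs : List ℕ} {Z Z' : ℕ → Set V}
    (h : ∀ c, c ∉ cs → Z c = Z' c) : G.solve p N cs Z = G.solve p N cs Z' := by
  induction cs generalizing Z Z' with
  | nil => rw [funext fun c => h c List.not_mem_nil]
  | cons c cs ih =>
    simp only [solve]
    congr 1
    funext X
    refine ih fun d hd => ?_
    by_cases hdc : d = c
    · simp only [hdc, Function.update_self]
    · rw [Function.update_of_ne hdc, Function.update_of_ne hdc]
      exact h d (by simp [hd, hdc])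

lemma compl_pre (p : Player) (X : Set V) : (G.pre p X)ᶜ = G.pre p.other Xᶜ := by
  ext v
  have h : G.owner v = p.other ↔ G.owner v ≠ p := by
    cases p <;> cases G.owner v <;> simp [Player.other]
  simp only [pre, Set.mem_compl_iff, Set.mem_ofPred_eq, h, ne_eq, not_not]
  by_cases ho : G.owner v = p <;> simp [ho]

lemma compl_solve (p : Player) (N : ℕ) (cs : List ℕ) (Z : ℕ → Set V) :
    (G.solve p N cs Z)ᶜ = G.solve p.other N cs (fun c => (Z c)ᶜ) := by
  induction cs generalizing Z with
  | nil => ext v; exact Set.ext_iff.1 (compl_pre p (Z (G.color v))) v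
  | cons c cs ih =>
    have hstart : {_v : V | Good p c}ᶜ = {_v : V | Good p.other c} := by ext; simp [good_other]
    have hstep : Function.Semiconj (·ᶜ) (fun X => G.solve p N cs (Function.update Z c X))
        (fun X => G.solve p.other N cs (Function.update (fun c => (Z c)ᶜ) c X)) := fun X =>
      (ih _).trans (congrArg _ (funext (Function.apply_update (fun _ => compl) Z c X)))
    simp only [solve, ← hstart]
    exact hstep.iterate_right N _

/-- The game has a move from `v` to `u`, which is the one prescribed by the positional strategy `g`
if `v` belongs to player `p`. -/
def Follows (G : ParityGame V) (p : Player) (g : V → V) (v u : V) : Prop :=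
  G.edge v u ∧ (G.owner v = p → u = g v)

/-- The move from `v` to `u` makes progress: if the color of `v` is not in `cs`, it leads to `Z c`,
otherwise it stays in `W`, does not increase the measures of larger colors, and decreases the
measure of the color of `v` unless this color is good. -/
structure Progress (G : ParityGame V) (p : Player) (cs : List ℕ) (Z : ℕ → Set V) (W : Set V)
    (μ : ℕ → V → ℕ) (v u : V) : Prop where
  exit : G.color v ∉ cs → u ∈ Z (G.color v)
  stay : G.color v ∈ cs → u ∈ W
  le : G.color v ∈ cs → ∀ c ∈ cs, G.color v ≤ c → μ c u ≤ μ c v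
  lt : G.color v ∈ cs → ¬ Good p (G.color v) → μ (G.color v) u < μ (G.color v) v

/-- A certificate for a region `W` (a progress measure together with a positional strategy):
all moves from `W` that follow the strategy `g` of player `p` make progress. -/
structure Certificate (G : ParityGame V) (p : Player) (cs : List ℕ) (Z : ℕ → Set V) (W : Set V)
    (g : V → V) (μ : ℕ → V → ℕ) : Prop where
  move : ∀ v ∈ W, G.owner v = p → G.edge v (g v)
  progress : ∀ v ∈ W, ∀ u, G.Follows p g v u → Progress G p cs Z W μ v u

lemma exists_certificate_nil (p : Player) (N : ℕ) (Z : ℕ → Set V) :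
    ∃ g μ, Certificate G p [] Z (G.solve p N [] Z) g μ := by
  classical
  choose! g hg using fun v (hv : v ∈ G.solve p N [] Z) => hv.1
  refine ⟨g, 0, fun v hv ho => (hg v hv ho).1, fun v hv u hu => ⟨fun _ => ?_, ?_, ?_, ?_⟩⟩
  · by_cases ho : G.owner v = p
    · exact hu.2 ho ▸ (hg v hv ho).2
    · exact hv.2 ho u hu.1
  all_goals exact fun h => absurd h List.not_mem_nil

lemma Certificate.cons_of_good {p : Player} {i : ℕ} {cs : List ℕ} {Z : ℕ → Set V} {X : Set V}
    {g : V → V} {μ : ℕ → V → ℕ} (hgood : Good p i) (hi : ∀ c ∈ cs, c < i)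
    (h : Certificate G p cs (Function.update Z i X) X g μ) :
    Certificate G p (i :: cs) Z X g (Function.update μ i 0) where
  move := h.move
  progress v hv u hu := by
    have hp := h.progress v hv u hu
    have mem_tail {c : ℕ} (hc : c ∈ i :: cs) (hci : c ≠ i) : c ∈ cs :=
      (List.mem_cons.1 hc).resolve_left hci
    refine ⟨fun hc => ?_, fun hc => ?_, fun hc c hc' hle => ?_, fun hc hb => ?_⟩
    · rw [List.mem_cons, not_or] at hc
      simpa only [Function.update_of_ne hc.1] using hp.exit hc.2
    · by_cases hci : G.color v = i
      · simpa only [hci, Function.update_self] using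
          hp.exit fun h => (hi _ h).ne hci
      · exact hp.stay (mem_tail hc hci)
    · by_cases hci : c = i
      · simp [hci]
      · have hlt := hi c (mem_tail hc' hci)
        simpa only [Function.update_of_ne hci] using
          hp.le (mem_tail hc (by omega)) c (mem_tail hc' hci) hle
    · have hci : G.color v ≠ i := fun h => hb (h ▸ hgood)
      simpa only [Function.update_of_ne hci] using hp.lt (mem_tail hc hci) hb

/-- The stage at which `v` enters the increasing sequence `X`, counted from the first stage after
`X 0`, which will be empty; it is `0` for a `v` that never enters. -/
noncomputable def rank (X : ℕ → Set V) (v : V) : ℕ := sInf {j | v ∈ X (j + 1)}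

lemma rank_lt_of_mem {X : ℕ → Set V} (hX : X 0 = ∅) {v : V} {j : ℕ} (hv : v ∈ X j) :
    rank X v < j := by
  cases j with
  | zero => simp [hX] at hv
  | succ j => exact Nat.lt_succ_of_le (Nat.sInf_le hv)

lemma mem_rank_add_one {X : ℕ → Set V} (hX : X 0 = ∅) {v : V} {j : ℕ} (hv : v ∈ X j) :
    v ∈ X (rank X v + 1) := by
  cases j with
  | zero => simp [hX] at hv
  | succ j => exact Nat.sInf_mem (s := {j | v ∈ X (j + 1)}) ⟨j, hv⟩

/-- The combination of the measures `μ j` for the stages `j` of the sequence `X`: the measure of the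
color `i` is the rank, and the other measures are ordered lexicographically after the rank,
provided that the measures `μ j` are smaller than `B`. -/
noncomputable def rankMeasure (X : ℕ → Set V) (B : ℕ) (μ : ℕ → ℕ → V → ℕ) (i : ℕ) : ℕ → V → ℕ :=
  Function.update (fun c v => rank X v * B + μ (rank X v) c v) i (rank X)

lemma Certificate.cons_of_rank {p : Player} {i : ℕ} {cs : List ℕ} {Z : ℕ → Set V}
    {X : ℕ → Set V} {g : ℕ → V → V} {μ : ℕ → ℕ → V → ℕ} {N B : ℕ} (hi : ∀ c ∈ cs, c < i)
    (hX : Monotone X) (hX0 : X 0 = ∅) (hB : ∀ j < N, ∀ c ∈ cs, ∀ v, μ j c v < B)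
    (h : ∀ j, Certificate G p cs (Function.update Z i (X j)) (X (j + 1)) (g j) (μ j)) :
    Certificate G p (i :: cs) Z (X N) (fun v => g (rank X v) v) (rankMeasure X B μ i) where
  move v hv := (h _).move v (mem_rank_add_one hX0 hv)
  progress v hv u hu := by
    have hp := (h _).progress v (mem_rank_add_one hX0 hv) u hu
    have hvN := rank_lt_of_mem hX0 hv
    have mem_tail {c : ℕ} (hc : c ∈ i :: cs) (hci : c ≠ i) : c ∈ cs :=
      (List.mem_cons.1 hc).resolve_left hci
    have mem_of_eq (hci : G.color v = i) : u ∈ X (rank X v) := by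
      simpa only [hci, Function.update_self] using hp.exit fun h => (hi _ h).ne hci
    have rank_le (hc : G.color v ∈ i :: cs) : rank X u ≤ rank X v := by
      by_cases hci : G.color v = i
      · exact (rank_lt_of_mem hX0 (mem_of_eq hci)).le
      · exact Nat.le_of_lt_succ (rank_lt_of_mem hX0 (hp.stay (mem_tail hc hci)))
    have lex {c : ℕ} (hc : c ∈ cs) (hlt : rank X u < rank X v) :
        rank X u * B + μ (rank X u) c u < rank X v * B + μ (rank X v) c v := by
      have := hB (rank X u) (hlt.trans hvN) c hc u
      have := Nat.mul_le_mul_right B hlt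
      rw [Nat.succ_mul] at this
      omega
    refine ⟨fun hc => ?_, fun hc => ?_, fun hc c hc' hle => ?_, fun hc hb => ?_⟩
    · rw [List.mem_cons, not_or] at hc
      simpa only [Function.update_of_ne hc.1] using hp.exit hc.2
    · by_cases hci : G.color v = i
      · exact hX hvN.le (mem_of_eq hci)
      · exact hX hvN (hp.stay (mem_tail hc hci))
    · by_cases hci : c = i
      · simpa only [rankMeasure, hci, Function.update_self] using rank_le hc
      · have hc' := mem_tail hc' hci
        have hlt := hi c hc'
        simp only [rankMeasure, Function.update_of_ne hci]
        rcases (rank_le hc).lt_or_eq with hrank | hrank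
        · exact (lex hc' hrank).le
        · rw [hrank]
          exact Nat.add_le_add_left (hp.le (mem_tail hc (by omega)) c hc' hle) _
    · by_cases hci : G.color v = i
      · simpa only [rankMeasure, hci, Function.update_self] using
          rank_lt_of_mem hX0 (mem_of_eq hci)
      · simp only [rankMeasure, Function.update_of_ne hci]
        rcases (rank_le hc).lt_or_eq with hrank | hrank
        · exact lex (mem_tail hc hci) hrank
        · rw [hrank]
          exact Nat.add_lt_add_left (hp.lt (mem_tail hc hci) hb) _

lemma exists_forall_measure_lt [Finite V] (μ : ℕ → ℕ → V → ℕ) (N : ℕ) (cs : List ℕ) :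
    ∃ B, ∀ j < N, ∀ c ∈ cs, ∀ v, μ j c v < B := by
  have hfin : (Set.range fun x : Fin N × {c // c ∈ cs} × V => μ x.1 x.2.1 x.2.2).Finite :=
    Set.finite_range _
  obtain ⟨B, hB⟩ := hfin.bddAbove
  exact ⟨B + 1, fun j hj c hc v => Nat.lt_succ_of_le (hB ⟨(⟨j, hj⟩, ⟨c, hc⟩, v), rfl⟩)⟩

lemma exists_certificate [Finite V] {p : Player} {N : ℕ} (hN : Nat.card V ≤ N)
    (cs : List ℕ) (hcs : cs.Pairwise (· > ·)) (Z : ℕ → Set V) :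
    ∃ g μ, Certificate G p cs Z (G.solve p N cs Z) g μ := by
  induction cs generalizing Z with
  | nil => exact exists_certificate_nil p N Z
  | cons i cs ih =>
    obtain ⟨hi, hcs⟩ := List.pairwise_cons.1 hcs
    set f : Set V → Set V := fun X => G.solve p N cs (Function.update Z i X) with hf
    have hfm : Monotone f := fun X Y h => solve_mono (update_le_update le_rfl i h)
    by_cases hgood : Good p i
    · have hW : G.solve p N (i :: cs) Z = f^[N] Set.univ := by simp [solve, hgood, hf]
      obtain ⟨g, μ, h⟩ := ih hcs (Function.update Z i (f^[N] Set.univ))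
      change Certificate G p cs _ (f (f^[N] Set.univ)) g μ at h
      rw [map_iterate_univ_eq hfm hN] at h
      exact hW ▸ ⟨g, _, h.cons_of_good hgood hi⟩
    · have hW : G.solve p N (i :: cs) Z = f^[N] ∅ := by simp [solve, hgood, hf]
      choose g μ h using fun j : ℕ => ih hcs (Function.update Z i (f^[j] ∅))
      obtain ⟨B, hB⟩ := exists_forall_measure_lt μ N cs
      have hstage (j : ℕ) : Certificate G p cs (Function.update Z i (f^[j] ∅)) (f^[j + 1] ∅)
          (g j) (μ j) := by
        rw [Function.iterate_succ_apply']
        exact h j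
      exact hW ▸ ⟨_, _, Certificate.cons_of_rank hi
        (hfm.monotone_iterate_of_le_map (Set.empty_subset _)) rfl hB hstage⟩

lemma Certificate.good_of_limsup {p : Player} {cs : List ℕ} {Z : ℕ → Set V} {W : Set V}
    {g : V → V} {μ : ℕ → V → ℕ} (h : Certificate G p cs Z W g μ) (hcs : ∀ v, G.color v ∈ cs)
    {ρ : ℕ → V} (hW : ∀ i, ρ i ∈ W) (hg : ∀ i, G.Follows p g (ρ i) (ρ (i + 1))) {m : ℕ}
    (hm : ∃ᶠ i in Filter.atTop, G.color (ρ i) = m)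
    (hle : ∀ᶠ i in Filter.atTop, G.color (ρ i) ≤ m) : Good p m := by
  by_contra hb
  have hP i : Progress G p cs Z W μ (ρ i) (ρ (i + 1)) := h.progress _ (hW i) _ (hg i)
  obtain ⟨i₀, hi₀⟩ := Filter.eventually_atTop.1 hle
  have hmc : m ∈ cs := by
    obtain ⟨i, hi⟩ := hm.exists
    exact hi ▸ hcs _
  have hanti : ∀ i ≥ i₀, ∀ j ≥ i, μ m (ρ j) ≤ μ m (ρ i) := fun i hi j hj => by
    induction j, hj using Nat.le_induction with
    | base => exact le_rfl
    | succ j hj ih => exact ((hP j).le (hcs _) m hmc (hi₀ j (by omega))).trans ih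
  have hdesc : ∀ K, ∃ i ≥ i₀, μ m (ρ i) + K ≤ μ m (ρ i₀) := fun K => by
    induction K with
    | zero => exact ⟨i₀, le_rfl, le_rfl⟩
    | succ K ih =>
      obtain ⟨i, hi, hK⟩ := ih
      obtain ⟨j, hj, rfl⟩ := Filter.frequently_atTop.1 hm i
      have hlt := (hP j).lt (hcs _) hb
      have := hanti i hi j hj
      exact ⟨j + 1, by omega, by omega⟩
  obtain ⟨i, -, hi⟩ := hdesc (μ m (ρ i₀) + 1)
  omega

lemma winCond_of_forall_good {p : Player} {ρ : ℕ → V}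
    (hbdd : ∃ b, ∀ᶠ i in Filter.atTop, G.color (ρ i) ≤ b)
    (hgood : ∀ m, (∃ᶠ i in Filter.atTop, G.color (ρ i) = m) →
      (∀ᶠ i in Filter.atTop, G.color (ρ i) ≤ m) → Good p m) : G.WinCond ρ p := by
  cases p with
  | O =>
    obtain ⟨m, hm, hle⟩ := exists_frequently_eq_and_eventually_le hbdd
    exact ⟨m, by simpa [Good] using hgood m hm hle, hm, hle⟩
  | I =>
    rintro ⟨m, he, hm, hle⟩
    simpa [Good, he] using hgood m hm hle

/-- The positional strategy `g` of player `p` wins from all vertices in `W`, without leaving `W`. -/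
structure PosWins (G : ParityGame V) (p : Player) (W : Set V) (g : V → V) : Prop where
  move : ∀ v ∈ W, G.owner v = p → G.edge v (g v)
  closed : ∀ v ∈ W, ∀ u, G.Follows p g v u → u ∈ W
  win : ∀ ρ : ℕ → V, ρ 0 ∈ W → (∀ i, G.Follows p g (ρ i) (ρ (i + 1))) → G.WinCond ρ p

lemma PosWins.mem {p : Player} {W : Set V} {g : V → V} (h : PosWins G p W g) {ρ : ℕ → V}
    (h0 : ρ 0 ∈ W) {m : ℕ} (hg : ∀ i < m, ρ i ∈ W → G.Follows p g (ρ i) (ρ (i + 1))) :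
    ρ m ∈ W := by
  induction m with
  | zero => exact h0
  | succ m ih =>
    have hm := ih fun i hi => hg i (hi.trans m.lt_succ_self)
    exact h.closed _ hm _ (hg m m.lt_succ_self hm)

lemma Certificate.posWins {p : Player} {cs : List ℕ} {Z : ℕ → Set V} {W : Set V} {g : V → V}
    {μ : ℕ → V → ℕ} (h : Certificate G p cs Z W g μ) (hcs : ∀ v, G.color v ∈ cs) :
    PosWins G p W g where
  move := h.move
  closed v hv u hu := (h.progress v hv u hu).stay (hcs v)
  win ρ h0 hg := by
    have hW i : ρ i ∈ W := by
      induction i with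
      | zero => exact h0
      | succ i ih => exact (h.progress _ ih _ (hg i)).stay (hcs _)
    exact winCond_of_forall_good
      ⟨cs.sum, .of_forall fun i => List.le_sum_of_mem (hcs _)⟩
      fun m hm hle => h.good_of_limsup hcs hW hg hm hle

lemma exists_posWins [Finite V] (p : Player) {N : ℕ} (hN : Nat.card V ≤ N) {cs : List ℕ}
    (hcs : cs.Pairwise (· > ·)) (hc : ∀ v, G.color v ∈ cs) (Z : ℕ → Set V) :
    ∃ g, PosWins G p (G.solve p N cs Z) g :=
  let ⟨g, _, h⟩ := exists_certificate hN cs hcs Z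
  ⟨g, h.posWins hc⟩

lemma PosWins.wins {p : Player} {W : Set V} {g : V → V} (h : PosWins G p W g)
    (hW : G.init ∈ W) : G.Wins p := by
  set f : List V → V := fun l => g (l.getLastD G.init) with hf
  have hf_map (ρ : ℕ → V) (m : ℕ) : f ((List.range (m + 1)).map ρ) = g (ρ m) := by
    simp [hf, List.range_succ]
  have follows {ρ : ℕ → V} {m i : ℕ} (hc : G.Consistent p f ρ m) (hi : i < m) :
      G.Follows p g (ρ i) (ρ (i + 1)) :=
    ⟨(hc.2 i hi).1, fun ho => ((hc.2 i hi).2 ho).trans (hf_map ρ i)⟩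
  have mem {ρ : ℕ → V} {m : ℕ} (hc : G.Consistent p f ρ m) : ρ m ∈ W :=
    h.mem (hc.1 ▸ hW) fun i hi _ => follows hc hi
  exact ⟨f, fun ρ m hc ho => (hf_map ρ m).symm ▸ h.move _ (mem hc) ho,
    fun ρ hc => h.win ρ (mem (hc 0)) fun i => follows (hc (i + 1)) i.lt_succ_self⟩

lemma exists_consistent {s : Player → List V → V}
    (hs : ∀ p ρ m, G.Consistent p (s p) ρ m → G.owner (ρ m) = p →
      G.edge (ρ m) (s p ((List.range (m + 1)).map ρ))) :
    ∃ ρ, ∀ p m, G.Consistent p (s p) ρ m := by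
  obtain ⟨ρ, hρ⟩ := exists_seq_eq_map_range fun l => match l.getLast? with
    | none => G.init
    | some v => s (G.owner v) l
  have hsucc (i : ℕ) : ρ (i + 1) = s (G.owner (ρ i)) ((List.range (i + 1)).map ρ) := by
    rw [hρ (i + 1)]
    simp only [List.range_succ, List.map_append, List.map_cons, List.map_nil,
      List.getLast?_concat]
  refine ⟨ρ, fun p m => ?_⟩
  induction m generalizing p with
  | zero => exact ⟨hρ 0, fun i hi => absurd hi i.not_lt_zero⟩
  | succ m ih =>
    refine ⟨hρ 0, fun i hi => ?_⟩
    rcases Nat.lt_succ_iff_lt_or_eq.1 hi with hi | rfl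
    · exact (ih p).2 i hi
    · exact ⟨hsucc i ▸ hs _ _ i (ih _) rfl, fun ho => by rw [hsucc, ho]⟩

lemma not_forall_wins (G : ParityGame V) : ¬ ∀ p, G.Wins p := by
  intro h
  choose s hs hw using h
  obtain ⟨ρ, hρ⟩ := exists_consistent hs
  exact hw .I ρ (hρ .I) (hw .O ρ (hρ .O))

lemma Follows.map {V' : Type*} {H : ParityGame V'} {e : V ≃ V'} (he : IsIso G H e) {p : Player}
    {g : V' → V'} {v u : V} (h : G.Follows p (fun v => e.symm (g (e v))) v u) :
    H.Follows p g (e v) (e u) :=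
  ⟨(he.edge v u).2 h.1, fun ho => (e.eq_symm_apply).1 (h.2 (he.owner v ▸ ho))⟩

lemma PosWins.comap {V' : Type*} {H : ParityGame V'} {e : V ≃ V'} (he : IsIso G H e)
    {p : Player} {W : Set V'} {g : V' → V'} (h : PosWins H p W g) :
    PosWins G p (e ⁻¹' W) (fun v => e.symm (g (e v))) where
  move v hv ho := by
    rw [← he.edge, e.apply_symm_apply]
    exact h.move (e v) hv (he.owner v ▸ ho)
  closed v hv u hu := h.closed (e v) hv _ (hu.map he)
  win ρ h0 hg := by
    have := h.win (fun i => e (ρ i)) h0 fun i => (hg i).map he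
    cases p <;> simpa only [WinCond, he.color] using this

end ParityGame

/-! ### The abstract game and its arena -/

lemma parityAccepting_comp_iff {w : ℕ → ℕ} {φ : ℕ → ℕ} (hφ : StrictMono φ)
    (hle : ∀ j ∉ Set.range φ, ∀ i, w j ≤ w (φ i)) :
    (ParityAccepting fun i => w (φ i)) ↔ ParityAccepting w := by
  constructor
  · rintro ⟨m, he, hm, hm'⟩
    refine ⟨m, he, hφ.tendsto_atTop.frequently hm, ?_⟩
    obtain ⟨i₀, hi₀⟩ := Filter.eventually_atTop.1 hm'
    filter_upwards [Filter.eventually_ge_atTop (φ i₀)] with j hj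
    by_cases hjφ : j ∈ Set.range φ
    · obtain ⟨i, rfl⟩ := hjφ
      exact hi₀ i (hφ.le_iff_le.1 hj)
    · exact (hle j hjφ i₀).trans (hi₀ i₀ le_rfl)
  · rintro ⟨m, he, hm, hm'⟩
    have hφm := hφ.tendsto_atTop.eventually hm'
    refine ⟨m, he, ?_, hφm⟩
    by_cases hout : ∃ j ∉ Set.range φ, w j = m
    · obtain ⟨j, hj, rfl⟩ := hout
      exact (hφm.mono fun i hi => le_antisymm hi (hle j hj i)).frequently
    · refine Filter.frequently_atTop.2 fun i₀ => ?_
      obtain ⟨j, hj, hjm⟩ := Filter.frequently_atTop.1 hm (φ i₀)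
      obtain ⟨i, rfl⟩ := not_not.1 fun hjφ => hout ⟨j, hjφ, hjm⟩
      exact ⟨i, hφ.le_iff_le.1 hj, hjm⟩

namespace DPA

open ParityGame

variable {Q I O : Type*} {𝔄 : DPA Q (I × O)} {k : ℕ}

@[simp] lemma dom_behavior (D : Set 𝔄.Pos) (w : List I) : dom (𝔄.behavior D w) = D := by
  ext x
  by_cases h : x ∈ D <;> simp [dom, behavior, h]

lemma dom_nonempty (r : 𝔄.behaviors k) : (dom r.1).Nonempty := by
  obtain ⟨r, w, D, _, hD, rfl⟩ := r
  rwa [dom_behavior]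

/-- The play of the arena that corresponds to a sequence of rounds of the abstract game. -/
def arenaPlay (ρ : ℕ → 𝔄.behaviors k × 𝔄.Pos) : ℕ → 𝔄.Vertex k
  | 0 => .start
  | j + 1 => if Even j then .fn (ρ (j / 2)).1 else .pair (ρ (j / 2)).1 (ρ (j / 2)).2

section ArenaPlay

variable (ρ : ℕ → 𝔄.behaviors k × 𝔄.Pos) (i : ℕ)

lemma arenaPlay_two_mul_add_one : arenaPlay ρ (2 * i + 1) = .fn (ρ i).1 := by
  simp [arenaPlay]

lemma arenaPlay_two_mul_add_two : arenaPlay ρ (2 * i + 2) = .pair (ρ i).1 (ρ i).2 := by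
  have hdiv : (2 * i + 1) / 2 = i := by omega
  simp [arenaPlay, hdiv, parity_simps]

lemma owner_arenaPlay_two_mul : (𝔄.arena k).owner (arenaPlay ρ (2 * i)) = .I := by
  cases i with
  | zero => rfl
  | succ i => rw [Nat.mul_succ, arenaPlay_two_mul_add_two]; rfl

lemma owner_arenaPlay_two_mul_add_one :
    (𝔄.arena k).owner (arenaPlay ρ (2 * i + 1)) = .O := by
  rw [arenaPlay_two_mul_add_one]; rfl

lemma forall_edge_arenaPlay_iff :
    (∀ j, (𝔄.arena k).edge (arenaPlay ρ j) (arenaPlay ρ (j + 1))) ↔ 𝔄.IsPlay k ρ := by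
  refine ⟨fun h => ⟨h 0, fun i => ?_, fun i => ?_⟩, fun h j => ?_⟩
  · have hE := h (2 * i + 2)
    rw [arenaPlay_two_mul_add_two, ← Nat.mul_succ, arenaPlay_two_mul_add_one] at hE
    exact hE
  · have hE := h (2 * i + 1)
    rw [arenaPlay_two_mul_add_one, arenaPlay_two_mul_add_two] at hE
    exact hE.2
  · rcases Nat.even_or_odd' j with ⟨_ | i, rfl | rfl⟩
    · exact h.start
    · exact ⟨rfl, h.answer 0⟩
    · rw [arenaPlay_two_mul_add_one, Nat.mul_succ, arenaPlay_two_mul_add_two]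
      exact h.next i
    · rw [arenaPlay_two_mul_add_one, arenaPlay_two_mul_add_two]
      exact ⟨rfl, h.answer (i + 1)⟩

lemma parityAccepting_arenaPlay_iff :
    (ParityAccepting fun j => (𝔄.arena k).color (arenaPlay ρ j)) ↔
      ParityAccepting fun i => ((ρ i).2.2 : ℕ) := by
  have hcolor (i : ℕ) : (𝔄.arena k).color (arenaPlay ρ (2 * i + 2)) = (ρ i).2.2 := by
    rw [arenaPlay_two_mul_add_two]; rfl
  rw [← parityAccepting_comp_iff (φ := fun i => 2 * i + 2) fun _ _ _ => by grind]
  · simp only [hcolor]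
  · intro j hj i
    rw [hcolor]
    refine Nat.sInf_le (?_ : _ ∈ Set.range 𝔄.color) |>.trans' ?_
    · exact (ρ i).2.2.2
    · rcases Nat.even_or_odd' j with ⟨_ | l, rfl | rfl⟩
      · exact le_rfl
      · exact le_rfl
      · exact absurd ⟨l, rfl⟩ hj
      · rw [arenaPlay_two_mul_add_one]; exact le_rfl

end ArenaPlay

lemma exists_answer_of_posWins {W : Set (𝔄.Vertex k)} {g : 𝔄.Vertex k → 𝔄.Vertex k}
    (h : (𝔄.arena k).PosWins .O W g) :
    ∃ τ : 𝔄.behaviors k → 𝔄.Pos, ∀ r, τ r ∈ dom r.1 ∧ (.fn r ∈ W → g (.fn r) = .pair r (τ r)) := by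
  have hanswer (r : 𝔄.behaviors k) : ∃ x, x ∈ dom r.1 ∧ (.fn r ∈ W → g (.fn r) = .pair r x) := by
    by_cases hr : .fn r ∈ W
    · have hE := h.move _ hr rfl
      cases hg : g (.fn r) with
      | start => rw [hg] at hE; exact hE.elim
      | fn r' => rw [hg] at hE; exact hE.elim
      | pair r' x =>
        rw [hg] at hE
        obtain ⟨rfl, hx⟩ := hE
        exact ⟨x, hx, fun _ => rfl⟩
    · obtain ⟨x, hx⟩ := dom_nonempty r
      exact ⟨x, hx, fun h => absurd h hr⟩
  choose τ hτ using hanswer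
  exact ⟨τ, hτ⟩

lemma oWins_of_posWins {W : Set (𝔄.Vertex k)} {g : 𝔄.Vertex k → 𝔄.Vertex k}
    (h : (𝔄.arena k).PosWins .O W g) (hW : .start ∈ W) : 𝔄.OWins k := by
  obtain ⟨τ, hτ⟩ := exists_answer_of_posWins h
  refine ⟨fun _ => τ, fun _ r => (hτ r).1, fun ρ hρ hσ => ?_⟩
  have follows (j : ℕ) (hj : arenaPlay ρ j ∈ W) :
      (𝔄.arena k).Follows .O g (arenaPlay ρ j) (arenaPlay ρ (j + 1)) := by
    refine ⟨(forall_edge_arenaPlay_iff ρ).2 hρ j, fun ho => ?_⟩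
    rcases Nat.even_or_odd' j with ⟨i, rfl | rfl⟩
    · rw [owner_arenaPlay_two_mul] at ho
      cases ho
    · rw [arenaPlay_two_mul_add_one] at hj ⊢
      rw [arenaPlay_two_mul_add_two, hσ i, (hτ _).2 hj]
  exact (parityAccepting_arenaPlay_iff ρ).1
    (h.win _ hW fun j => follows j (h.mem hW fun i _ => follows i))

lemma exists_challenge_of_posWins {W : Set (𝔄.Vertex k)} {g : 𝔄.Vertex k → 𝔄.Vertex k}
    (h : (𝔄.arena k).PosWins .I W g) (hW : .start ∈ W) :
    ∃ γ : 𝔄.Vertex k → 𝔄.behaviors k,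
      ∀ v ∈ W, (𝔄.arena k).owner v = .I → g v = .fn (γ v) := by
  have hfn : ∀ v, v ∈ W → (𝔄.arena k).owner v = .I → ∃ r, g v = .fn r := fun v hv ho => by
    have hE := h.move v hv ho
    cases hg : g v with
    | fn r => exact ⟨r, rfl⟩
    | start => rw [hg] at hE; cases v <;> exact hE.elim
    | pair r x =>
      rw [hg] at hE
      cases v with
      | fn r => cases ho
      | _ => exact hE.elim
  have : Nonempty (𝔄.behaviors k) := ⟨(hfn _ hW rfl).choose⟩
  choose! γ hγ using hfn
  exact ⟨γ, hγ⟩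

lemma exists_rounds (γ : 𝔄.Vertex k → 𝔄.behaviors k)
    (σ : List (𝔄.behaviors k × 𝔄.Pos) → 𝔄.behaviors k → 𝔄.Pos) :
    ∃ ρ : ℕ → 𝔄.behaviors k × 𝔄.Pos, (∀ i, (ρ i).1 = γ (arenaPlay ρ (2 * i))) ∧
      ∀ i, (ρ i).2 = σ ((List.range i).map ρ) (ρ i).1 := by
  obtain ⟨ρ, hρ⟩ := exists_seq_eq_map_range fun l =>
    let r := γ (match l.getLast? with
      | none => .start
      | some x => .pair x.1 x.2)
    (r, σ l r)
  refine ⟨ρ, fun i => ?_, fun i => by rw [hρ i]⟩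
  rw [hρ i]
  cases i with
  | zero => rfl
  | succ i =>
    rw [Nat.mul_succ, arenaPlay_two_mul_add_two]
    simp only [List.range_succ, List.map_append, List.map_cons, List.map_nil,
      List.getLast?_concat]

lemma not_oWins_of_posWins {W : Set (𝔄.Vertex k)} {g : 𝔄.Vertex k → 𝔄.Vertex k}
    (h : (𝔄.arena k).PosWins .I W g) (hW : .start ∈ W) : ¬ 𝔄.OWins k := by
  rintro ⟨σ, hσ, hwin⟩
  obtain ⟨γ, hγ⟩ := exists_challenge_of_posWins h hW
  obtain ⟨ρ, hργ, hρσ⟩ := exists_rounds γ σ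
  have hpre (j : ℕ) (hj : arenaPlay ρ j ∈ W) :
      (𝔄.arena k).Follows .I g (arenaPlay ρ j) (arenaPlay ρ (j + 1)) := by
    rcases Nat.even_or_odd' j with ⟨i, rfl | rfl⟩
    · have hg := hγ _ hj (owner_arenaPlay_two_mul ρ i)
      rw [← hργ, ← arenaPlay_two_mul_add_one] at hg
      exact ⟨hg ▸ h.move _ hj (owner_arenaPlay_two_mul ρ i), fun _ => hg.symm⟩
    · refine ⟨?_, fun ho => ?_⟩
      · rw [arenaPlay_two_mul_add_one, arenaPlay_two_mul_add_two]
        exact ⟨rfl, hρσ i ▸ hσ _ _⟩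
      · rw [owner_arenaPlay_two_mul_add_one] at ho
        cases ho
  have follows j := hpre j (h.mem hW fun i _ => hpre i)
  have hplay := (forall_edge_arenaPlay_iff ρ).1 fun j => (follows j).1
  exact h.win _ hW follows ((parityAccepting_arenaPlay_iff ρ).2 (hwin ρ hplay hρσ))

end DPA

/-! ### The algorithm -/

/-- The inputs of the algorithm. -/
structure Input where
  n : ℕ
  s : ℕ
  t : ℕ
  k : ℕ
  aut : DPA (Fin n) (Fin s × Fin t)
  t_pos : 0 < t
  k_le : k ≤ 2 ^ (n ^ 2 * aut.numColors + 1)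

/-- Codes of the positions in `Q × C`: the number of a state and a color. -/
abbrev PosCode := ℕ × ℕ

/-- Codes of the functions `q ↦ δ_𝒫^*({(q, Ω(q))}, w)`, as lists of arguments and values. -/
abbrev FunCode := List (ℕ × List PosCode)

/-- Codes of the partial functions `r_w^D`, as lists of arguments and values. -/
abbrev BehaviorCode := List (PosCode × List PosCode)

/-- Codes of the vertices of the arena. The first tag tells whether the vertex is a function, the
second one whether it is a pair; components that do not apply are empty. -/
abbrev VertexCode := (Bool × Bool) × (BehaviorCode × PosCode)

/-- The code of the initial vertex. -/
abbrev VertexCode.start : VertexCode := ((false, false), ([], (0, 0)))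

/-- The code of the vertex of Player `I` given by a function and a position. -/
abbrev VertexCode.pair (r : BehaviorCode) (x : PosCode) : VertexCode := ((false, true), (r, x))

/-- The code of the vertex of Player `O` given by a function. -/
abbrev VertexCode.fn (r : BehaviorCode) : VertexCode := ((true, false), (r, (0, 0)))

/-- Codes of families of sets of vertices indexed by colors, as lists of pairs of a color and a
member of the set for this color. -/
abbrev FamilyCode := List (ℕ × VertexCode)

/-- Instructions of the fixpoint computation, which operates on a family of sets of vertices
indexed by the colors and on a set of vertices, the result. -/
abbrev Instruction := (Bool × Bool) × ℕ

/-- The instruction to store in the result the vertices from which Player `O` can force the next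
vertex to be in the set for the color of the current one. -/
abbrev Instruction.compute : Instruction := ((false, false), 0)

/-- The instruction to start the fixpoint iteration for the color `c`. -/
abbrev Instruction.reset (c : ℕ) : Instruction := ((true, true), c)

/-- The instruction to make the result the set for the color `c`. -/
abbrev Instruction.assign (c : ℕ) : Instruction := ((true, false), c)

/-- The value of a function at a state. -/
def FunCode.value (f : FunCode) (q : ℕ) : List PosCode :=
  (f.filter fun p => p.1 == q).flatMap Prod.snd

namespace Input

/-- The number of the initial state. -/
def initState (γ : Input) : ℕ := γ.aut.init

/-- The table of the transitions, as it occurs in the input. -/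
def table (γ : Input) : List (List (List ℕ)) :=
  List.ofFn fun q => List.ofFn fun a => List.ofFn fun b => ((γ.aut.step q (a, b) : Fin γ.n) : ℕ)

/-- The table of the colors of the states, as it occurs in the input. -/
def colorTable (γ : Input) : List ℕ := List.ofFn γ.aut.color

-- The summand `2 ^ n ^ 4` makes polynomial time in the weight the same as the required time bound.
instance : TreeEncoding Input where
  enc γ := encodeInput γ.aut γ.k
  weight γ := (encodeInput γ.aut γ.k).size + 1 + 2 ^ γ.n ^ 4
  size_enc_lt_weight _ := Nat.lt_of_lt_of_le (Nat.lt_succ_self _) (Nat.le_add_right _ _)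

/-- The transitions, as triples of a state, an input letter, and the next state. -/
def transitions (γ : Input) : List (ℕ × (ℕ × ℕ)) :=
  γ.table.zipIdx.flatMap fun x => x.1.zipIdx.flatMap fun y => y.1.map fun q' => (x.2, (y.2, q'))

/-- The input letters, possibly with repetitions. -/
def letters (γ : Input) : List ℕ := γ.transitions.map fun τ => τ.2.1

/-- The pairs of the color of a state and this state. -/
def stateColors (γ : Input) : List (ℕ × ℕ) := γ.colorTable.zipIdx

/-- The colors in decreasing order, without repetitions. -/
def colors (γ : Input) : List ℕ := γ.colorTable.dedup.insertionSort (· ≥ ·)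

/-- The minimal color. -/
def minColor (γ : Input) : ℕ := (γ.colorTable.insertionSort (· ≤ ·)).headD 0

/-- The list of all positions. -/
def positions (γ : Input) : List PosCode :=
  γ.stateColors.flatMap fun c => γ.colors.map fun e => (c.2, e)

/-- The map `δ_𝒫` on codes. Sets of positions are represented by sublists of `positions`, which
makes the representation unique. -/
def stepSet (γ : Input) (X : List PosCode) (a : ℕ) : List PosCode :=
  γ.positions.filter fun y => X.any fun x => γ.transitions.any fun τ =>
    τ.1 == x.1 && (τ.2.1 == a && (τ.2.2 == y.1 && γ.stateColors.any fun c =>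
      c.2 == y.1 && y.2 == max x.2 c.1))

/-- The code of `{(q, Ω(q))}`. -/
def initSet (γ : Input) (q : ℕ) : List PosCode :=
  γ.positions.filter fun y => y.1 == q && γ.stateColors.any fun c => c == (y.2, q)

/-- The effect on `q ↦ δ_𝒫^*({(q, Ω(q))}, w)` of appending a letter to `w`. -/
def stepFun (γ : Input) (f : FunCode) (a : ℕ) : FunCode :=
  f.map fun p => (p.1, γ.stepSet p.2 a)

/-- The code of `q ↦ {(q, Ω(q))}`. -/
def initFun (γ : Input) : FunCode := γ.stateColors.map fun c => (c.2, γ.initSet c.2)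

/-- The effect on the set of the functions `q ↦ δ_𝒫^*({(q, Ω(q))}, w)`, for all words `w` of some
length, of increasing this length by one. -/
def stepLayer (γ : Input) (L : List FunCode) : List FunCode :=
  (L.flatMap fun f => γ.letters.map fun a => γ.stepFun f a).dedup

/-- The functions `q ↦ δ_𝒫^*({(q, Ω(q))}, w)` for words `w` of length `k`. -/
def layer (γ : Input) (k : ℕ) : List FunCode :=
  (List.replicate k ()).foldl (fun L _ => γ.stepLayer L) [γ.initFun]

/-- The sets of positions. -/
def positionSets (γ : Input) : List (List PosCode) := γ.positions.sublists'

/-- The set `ℜ`. -/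
def behaviorList (γ : Input) : List BehaviorCode :=
  (γ.positionSets.flatMap fun D => bif D == [] then [] else
    (γ.layer γ.k).map fun f => D.map fun x => (x, f.value x.1)).dedup

/-- The vertices of the arena. -/
def vertexList (γ : Input) : List VertexCode :=
  .start :: (γ.behaviorList.map (fun r => .fn r) ++
    γ.behaviorList.flatMap fun r => γ.positions.map fun x => .pair r x)

/-- The edge relation of the arena. -/
def edge (γ : Input) (v v' : VertexCode) : Bool :=
  (!v.1.1 && (v'.1.1 && bif v.1.2 then
      v.2.1.any fun e => e.1 == v.2.2 && e.2 == v'.2.1.map Prod.fst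
    else v'.2.1.map Prod.fst == γ.initSet γ.initState)) ||
  (v.1.1 && (v'.1.2 && (v'.2.1 == v.2.1 && v.2.1.any fun e => e.1 == v'.2.2)))

/-- The colors of the vertices of the arena. -/
def vertexColor (γ : Input) (v : VertexCode) : ℕ := bif v.1.2 then v.2.2.2 else γ.minColor

/-- Whether Player `O` can force the vertex after `v` to be in the set for the color of `v`. -/
def canForce (γ : Input) (Z : FamilyCode) (v : VertexCode) : Bool :=
  bif v.1.1 then
    γ.vertexList.any fun u => γ.edge v u && Z.any fun z => z == (γ.vertexColor v, u)
  else γ.vertexList.all fun u => !γ.edge v u || Z.any fun z => z == (γ.vertexColor v, u)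

/-- The pairs of a color and a vertex. -/
def coloredVertices (γ : Input) : FamilyCode :=
  γ.colors.flatMap fun c => γ.vertexList.map fun v => (c, v)

/-- Execute an instruction. The iteration for an even color computes a greatest fixpoint, so it
starts with the set of all vertices. -/
def exec (γ : Input) (st : FamilyCode × List VertexCode) (i : Instruction) :
    FamilyCode × List VertexCode :=
  bif i.1.1 then
    (γ.coloredVertices.filter fun x =>
      bif x.1 == i.2 then bif i.1.2 then !i.2.bodd else st.2.any fun v => v == x.2
      else st.1.any fun z => z == x, st.2)
  else (st.1, γ.vertexList.filter fun v => γ.canForce st.1 v)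

/-- The instructions that compute the nested fixpoint for the colors in `cs`. Unrolling it into a
list, which has exponential length, turns the nested iteration into recursion on a single list. -/
def instructions (γ : Input) (cs : List ℕ) : List Instruction :=
  cs.foldr (fun c I => .reset c :: γ.vertexList.flatMap fun _ => I ++ [.assign c]) [.compute]

/-- The vertices from which Player `O` wins. -/
def winRegion (γ : Input) : List VertexCode :=
  ((γ.instructions γ.colors).foldl γ.exec ([], [])).2

/-- Whether Player `O` wins from the initial vertex. -/
def winnerIsO (γ : Input) : Bool := γ.winRegion.any fun v => v == .start

/-- The arena and the winner: the initial vertex, the owners, the colors, the adjacency matrix, and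
whether Player `O` wins. -/
def output (γ : Input) : (ℕ × (List Bool × (List ℕ × List (List Bool)))) × Bool :=
  ((0, (γ.vertexList.map fun v => v.1.1, (γ.vertexList.map γ.vertexColor,
    γ.vertexList.map fun v => γ.vertexList.map fun v' => γ.edge v v'))), γ.winnerIsO)

end Input

namespace PolyTime

lemma input : PolyTime fun γ : Input => ((γ.initState, (γ.table, γ.colorTable)), γ.k) :=
  .of_enc_eq (fun _ => rfl) fun γ => by
    rw [SizeWeighted.weight_eq]
    exact Nat.le_add_right ((encodeInput γ.aut γ.k).size + 1) _

@[fun_prop] lemma initState : PolyTime Input.initState := fst.comp (fst.comp input)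

@[fun_prop] lemma table : PolyTime Input.table := fst.comp (snd.comp (fst.comp input))

@[fun_prop] lemma colorTable : PolyTime Input.colorTable := snd.comp (snd.comp (fst.comp input))

@[fun_prop] lemma exponent : PolyTime Input.k := snd.comp input

@[fun_prop] lemma transitions : PolyTime Input.transitions := by unfold Input.transitions; fun_prop

@[fun_prop] lemma letters : PolyTime Input.letters := by unfold Input.letters; fun_prop

@[fun_prop] lemma stateColors : PolyTime Input.stateColors := by unfold Input.stateColors; fun_prop

@[fun_prop] lemma colors : PolyTime Input.colors := by unfold Input.colors; fun_prop

@[fun_prop] lemma minColor : PolyTime Input.minColor := by unfold Input.minColor; fun_prop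

@[fun_prop] lemma positions : PolyTime Input.positions := by unfold Input.positions; fun_prop

variable {α : Type*} [TreeEncoding α] {γ : α → Input}

@[fun_prop] lemma value {f : α → FunCode} {q : α → ℕ} (hf : PolyTime f) (hq : PolyTime q) :
    PolyTime fun a => (f a).value (q a) := by
  unfold FunCode.value; fun_prop

@[fun_prop] lemma stepSet {X : α → List PosCode} {b : α → ℕ}
    (hγ : PolyTime γ) (hX : PolyTime X) (hb : PolyTime b) :
    PolyTime fun a => (γ a).stepSet (X a) (b a) := by
  unfold Input.stepSet; fun_prop

@[fun_prop] lemma initSet {q : α → ℕ} (hγ : PolyTime γ) (hq : PolyTime q) :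
    PolyTime fun a => (γ a).initSet (q a) := by
  unfold Input.initSet; fun_prop

@[fun_prop] lemma stepFun {f : α → FunCode} {b : α → ℕ}
    (hγ : PolyTime γ) (hf : PolyTime f) (hb : PolyTime b) :
    PolyTime fun a => (γ a).stepFun (f a) (b a) := by
  unfold Input.stepFun; fun_prop

@[fun_prop] lemma initFun : PolyTime Input.initFun := by unfold Input.initFun; fun_prop

@[fun_prop] lemma stepLayer {L : α → List FunCode} (hγ : PolyTime γ) (hL : PolyTime L) :
    PolyTime fun a => (γ a).stepLayer (L a) := by
  unfold Input.stepLayer; fun_prop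

end PolyTime

/-! ### Correctness of the construction of the arena -/

lemma zipIdx_ofFn {β : Type*} {m : ℕ} (f : Fin m → β) :
    (List.ofFn f).zipIdx = List.ofFn fun i => (f i, (i : ℕ)) := by
  apply List.ext_getElem <;> simp

lemma eq_filter_of_sublist {β : Type*} {l l' : List β} [DecidablePred (· ∈ l')] (hl : l.Nodup)
    (h : l'.Sublist l) : l' = l.filter (· ∈ l') := by
  have hsub := h.filter (· ∈ l')
  rw [List.filter_eq_self.2 fun x hx => decide_eq_true hx] at hsub
  refine hsub.eq_of_length_le (List.subperm_of_subset (hl.filter _) fun x hx => ?_).length_le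
  exact of_decide_eq_true (List.mem_filter.1 hx).2

namespace Input

variable (γ : Input)

lemma mem_transitions {τ : ℕ × ℕ × ℕ} : τ ∈ γ.transitions ↔
    ∃ (q : Fin γ.n) (a : Fin γ.s) (b : Fin γ.t), τ = (↑q, ↑a, ↑(γ.aut.step q (a, b))) := by
  simp [transitions, table, zipIdx_ofFn, eq_comm]

lemma mem_letters {a : ℕ} : a ∈ γ.letters ↔ ∃ a' : Fin γ.s, a = a' := by
  have := Fin.pos_iff_nonempty.1 γ.t_pos
  have : Nonempty (Fin γ.n) := ⟨γ.aut.init⟩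
  simp [letters, mem_transitions, eq_comm]

lemma mem_colorTable {e : ℕ} : e ∈ γ.colorTable ↔ e ∈ Set.range γ.aut.color := List.mem_ofFn

lemma stateColors_eq : γ.stateColors = List.ofFn fun q => (γ.aut.color q, (q : ℕ)) :=
  zipIdx_ofFn _

lemma mem_stateColors {c : ℕ × ℕ} :
    c ∈ γ.stateColors ↔ ∃ q : Fin γ.n, c = (γ.aut.color q, ↑q) := by
  simp [stateColors_eq, List.mem_ofFn, eq_comm]

lemma mem_colors {e : ℕ} : e ∈ γ.colors ↔ e ∈ Set.range γ.aut.color := by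
  rw [colors, List.mem_insertionSort, List.mem_dedup, mem_colorTable]

lemma nodup_colors : γ.colors.Nodup :=
  (List.perm_insertionSort _ _).nodup_iff.2 (List.nodup_dedup _)

lemma pairwise_colors : γ.colors.Pairwise (· > ·) :=
  (List.pairwise_insertionSort (· ≥ ·) γ.colorTable.dedup).and γ.nodup_colors |>.imp
    fun h => lt_of_le_of_ne h.1 h.2.symm

lemma minColor_eq : γ.minColor = sInf (Set.range γ.aut.color) := by
  have hsorted := List.pairwise_insertionSort (· ≤ ·) γ.colorTable
  have hmem (e) : e ∈ γ.colorTable.insertionSort (· ≤ ·) ↔ e ∈ Set.range γ.aut.color := by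
    rw [List.mem_insertionSort, mem_colorTable]
  rw [minColor]
  cases h : γ.colorTable.insertionSort (· ≤ ·) with
  | nil => exact absurd ((hmem _).2 ⟨γ.aut.init, rfl⟩) (by simp [h])
  | cons m l =>
    rw [h, List.pairwise_cons] at hsorted
    simp only [h, List.mem_cons] at hmem
    refine (IsLeast.csInf_eq ⟨(hmem m).1 (.inl rfl), fun e he => ?_⟩).symm
    exact ((hmem e).2 he).elim (fun h => h.ge) (hsorted.1 e)

/-- The code of a position. -/
def posCode (x : γ.aut.Pos) : PosCode := (x.1, x.2)

lemma posCode_injective : Function.Injective γ.posCode := fun x y h => by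
  simp only [posCode, Prod.mk.injEq] at h
  exact Prod.ext (Fin.ext h.1) (Subtype.ext h.2)

lemma mem_positions {y : PosCode} : y ∈ γ.positions ↔ y ∈ Set.range γ.posCode := by
  obtain ⟨q, e⟩ := y
  simp [positions, mem_stateColors, mem_colors, posCode, eq_comm]

lemma nodup_positions : γ.positions.Nodup := by
  rw [positions, List.nodup_flatMap]
  refine ⟨fun c _ => γ.nodup_colors.map fun _ _ h => (Prod.mk.inj h).2, ?_⟩
  rw [stateColors_eq, List.pairwise_ofFn]
  intro i j hij
  simp only [Function.onFun, List.disjoint_left, List.mem_map]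
  rintro _ ⟨e, -, rfl⟩ ⟨e', -, h⟩
  exact hij.ne' (Fin.ext (Prod.mk.inj h).1)

open Classical in
/-- The code of a set of positions. -/
noncomputable def setCode (X : Set γ.aut.Pos) : List PosCode :=
  γ.positions.filter (· ∈ γ.posCode '' X)

variable {γ} in
lemma mem_setCode {X : Set γ.aut.Pos} {y : PosCode} :
    y ∈ γ.setCode X ↔ y ∈ γ.posCode '' X := by
  simp only [setCode, List.mem_filter, decide_eq_true_eq, mem_positions, and_iff_right_iff_imp]
  exact fun h => Set.image_subset_range _ _ h

variable {γ} in
lemma posCode_mem_setCode {X : Set γ.aut.Pos} {x : γ.aut.Pos} :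
    γ.posCode x ∈ γ.setCode X ↔ x ∈ X := by
  rw [mem_setCode, γ.posCode_injective.mem_set_image]

lemma setCode_injective : Function.Injective γ.setCode := fun X Y h => by
  ext x
  rw [← posCode_mem_setCode, h, posCode_mem_setCode]

lemma filter_positions_eq_setCode {X : Set γ.aut.Pos} {p : PosCode → Bool}
    (h : ∀ x, p (γ.posCode x) = true ↔ x ∈ X) : γ.positions.filter p = γ.setCode X := by
  classical
  refine List.filter_congr fun y hy => ?_
  obtain ⟨x, rfl⟩ := γ.mem_positions.1 hy
  rw [Bool.eq_iff_iff, h, decide_eq_true_eq, γ.posCode_injective.mem_set_image]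

lemma coe_max (c d : γ.aut.Col) : ((max c d : γ.aut.Col) : ℕ) = max (c : ℕ) d :=
  (Subtype.mono_coe (· ∈ Set.range γ.aut.color)).map_max

lemma stepSet_setCode (X : Set γ.aut.Pos) (a : Fin γ.s) :
    γ.stepSet (γ.setCode X) a = γ.setCode (γ.aut.stepP X a) := by
  refine γ.filter_positions_eq_setCode fun ⟨q', e'⟩ => ?_
  simp only [List.any_eq_true, Bool.and_eq_true, beq_iff_eq, mem_setCode, mem_transitions,
    mem_stateColors, posCode, DPA.stepP, DPA.stepT, Set.mem_ofPred_eq, Set.mem_image]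
  constructor
  · rintro ⟨_, ⟨⟨q, e⟩, hx, rfl⟩, _, ⟨q₀, a₀, b, rfl⟩, hq, ha, hq', _, ⟨q₁, rfl⟩, hq₁, he⟩
    obtain rfl := Fin.ext hq
    obtain rfl := Fin.ext ha
    obtain rfl := Fin.ext hq'
    obtain rfl := Fin.ext hq₁
    exact ⟨_, hx, b, Prod.ext rfl (Subtype.ext (he.trans (γ.coe_max e (γ.aut.colorOf _)).symm))⟩
  · rintro ⟨x, hx, b, h⟩
    obtain ⟨rfl, rfl⟩ := Prod.mk.inj h
    exact ⟨_, ⟨x, hx, rfl⟩, _, ⟨x.1, a, b, rfl⟩, rfl, rfl, rfl, _, ⟨_, rfl⟩, rfl, γ.coe_max _ _⟩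

lemma initSet_eq (q : Fin γ.n) : γ.initSet q = γ.setCode {(q, γ.aut.colorOf q)} := by
  refine γ.filter_positions_eq_setCode fun ⟨q', e⟩ => ?_
  simp only [Bool.and_eq_true, beq_iff_eq, List.any_eq_true, Set.mem_singleton_iff,
    mem_stateColors, posCode]
  constructor
  · rintro ⟨hq, _, ⟨q₀, rfl⟩, h⟩
    obtain rfl := Fin.ext hq
    obtain ⟨he, hq₀⟩ := Prod.mk.inj h
    obtain rfl := Fin.ext hq₀
    exact Prod.ext rfl (Subtype.ext he.symm)
  · rintro h
    obtain ⟨rfl, rfl⟩ := Prod.mk.inj h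
    exact ⟨rfl, _, ⟨q', rfl⟩, rfl⟩

/-- The code of a function from the states to sets of positions. -/
noncomputable def funCode (F : Fin γ.n → Set γ.aut.Pos) : FunCode :=
  (List.finRange γ.n).map fun q : Fin γ.n => ((q : ℕ), γ.setCode (F q))

lemma value_funCode (F : Fin γ.n → Set γ.aut.Pos) (q : Fin γ.n) :
    (γ.funCode F).value q = γ.setCode (F q) := by
  have hfilter : (List.finRange γ.n).filter (fun p : Fin γ.n => (p : ℕ) == q) =
      ([q] : List (Fin γ.n)) := by
    simp only [beq_eq_decide, Fin.val_inj]
    rw [List.filter_eq q, List.count_eq_one_of_mem (List.nodup_finRange _) (List.mem_finRange q)]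
    rfl
  simp only [FunCode.value, funCode, List.filter_map, Function.comp_def, hfilter]
  exact List.append_nil _

lemma initFun_eq : γ.initFun = γ.funCode fun q => {(q, γ.aut.colorOf q)} := by
  simp only [initFun, stateColors_eq, List.ofFn_eq_map, List.map_map, funCode, Function.comp_def,
    initSet_eq]

lemma stepFun_funCode (F : Fin γ.n → Set γ.aut.Pos) (a : Fin γ.s) :
    γ.stepFun (γ.funCode F) a = γ.funCode fun q => γ.aut.stepP (F q) a := by
  simp only [stepFun, funCode, List.map_map, Function.comp_def, stepSet_setCode]

/-- The code of the function `q ↦ δ_𝒫^*({(q, Ω(q))}, w)`. -/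
noncomputable def wordCode (w : List (Fin γ.s)) : FunCode :=
  γ.funCode fun q => γ.aut.stepPStar {(q, γ.aut.colorOf q)} w

lemma stepFun_wordCode (w : List (Fin γ.s)) (a : Fin γ.s) :
    γ.stepFun (γ.wordCode w) a = γ.wordCode (w ++ [a]) := by
  simp only [wordCode, stepFun_funCode, DPA.stepPStar, List.foldl_append, List.foldl_cons,
    List.foldl_nil]

lemma layer_succ (j : ℕ) : γ.layer (j + 1) = γ.stepLayer (γ.layer j) := by
  rw [layer, List.replicate_succ', List.foldl_append]
  rfl

lemma mem_layer {j : ℕ} {f : FunCode} :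
    f ∈ γ.layer j ↔ ∃ w : List (Fin γ.s), w.length = j ∧ f = γ.wordCode w := by
  induction j generalizing f with
  | zero =>
    simp only [List.length_eq_zero_iff, exists_eq_left]
    exact List.mem_singleton.trans (by rw [initFun_eq]; rfl)
  | succ j ih =>
    simp only [layer_succ, stepLayer, List.mem_dedup, List.mem_flatMap, List.mem_map, ih,
      mem_letters]
    constructor
    · rintro ⟨_, ⟨w, hw, rfl⟩, _, ⟨a, rfl⟩, rfl⟩
      exact ⟨w ++ [a], by simp [hw], γ.stepFun_wordCode w a⟩
    · rintro ⟨w, hw, rfl⟩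
      rcases List.eq_nil_or_concat' w with rfl | ⟨w, a, rfl⟩
      · simp at hw
      · exact ⟨_, ⟨w, by simpa using hw, rfl⟩, _, ⟨a, rfl⟩, γ.stepFun_wordCode w a⟩

lemma nodup_layer (j : ℕ) : (γ.layer j).Nodup := by
  cases j with
  | zero => exact List.nodup_singleton _
  | succ j =>
    rw [layer_succ]
    exact List.nodup_dedup _

/-- The code of a partial function. -/
noncomputable def behaviorCode (r : γ.aut.PartialFun) : BehaviorCode :=
  (γ.setCode (DPA.dom r)).map fun y =>
    (y, γ.setCode {z | ∃ x X, γ.posCode x = y ∧ r x = some X ∧ z ∈ X})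

lemma map_fst_behaviorCode (r : γ.aut.PartialFun) :
    (γ.behaviorCode r).map Prod.fst = γ.setCode (DPA.dom r) := by
  simp [behaviorCode, Function.comp_def]

lemma setOf_posCode_eq {r : γ.aut.PartialFun} {x : γ.aut.Pos} {X : Set γ.aut.Pos}
    (hX : r x = some X) :
    {z | ∃ x' X', γ.posCode x' = γ.posCode x ∧ r x' = some X' ∧ z ∈ X'} = X := by
  ext z
  simp [γ.posCode_injective.eq_iff, hX]

lemma mem_behaviorCode {r : γ.aut.PartialFun} {y : PosCode} {L : List PosCode} :
    (y, L) ∈ γ.behaviorCode r ↔ ∃ x X, r x = some X ∧ γ.posCode x = y ∧ γ.setCode X = L := by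
  simp only [behaviorCode, List.mem_map, mem_setCode, Prod.mk.injEq]
  constructor
  · rintro ⟨_, ⟨x, hx, rfl⟩, rfl, rfl⟩
    obtain ⟨X, hX⟩ := Option.isSome_iff_exists.1 hx
    exact ⟨x, X, hX, rfl, by rw [γ.setOf_posCode_eq hX]⟩
  · rintro ⟨x, X, hX, rfl, rfl⟩
    exact ⟨_, ⟨x, Option.isSome_iff_exists.2 ⟨X, hX⟩, rfl⟩, rfl, by rw [γ.setOf_posCode_eq hX]⟩

lemma posCode_setCode_mem_behaviorCode {r : γ.aut.PartialFun} {x : γ.aut.Pos}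
    {X : Set γ.aut.Pos} :
    (γ.posCode x, γ.setCode X) ∈ γ.behaviorCode r ↔ r x = some X := by
  rw [mem_behaviorCode]
  constructor
  · rintro ⟨x', X', h, hx, hX⟩
    rwa [γ.posCode_injective hx, γ.setCode_injective hX] at h
  · exact fun h => ⟨x, X, h, rfl, rfl⟩

lemma behaviorCode_injective : Function.Injective γ.behaviorCode := fun r r' h => by
  ext x X : 2
  rw [← posCode_setCode_mem_behaviorCode, h, posCode_setCode_mem_behaviorCode]

lemma behaviorCode_behavior (D : Set γ.aut.Pos) (w : List (Fin γ.s)) :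
    γ.behaviorCode (γ.aut.behavior D w) =
      (γ.setCode D).map fun y => (y, (γ.wordCode w).value y.1) := by
  rw [behaviorCode, DPA.dom_behavior]
  refine List.map_congr_left fun y hy => ?_
  obtain ⟨x, hx, rfl⟩ := mem_setCode.1 hy
  have hr : γ.aut.behavior D w x = some _ := if_pos hx
  rw [γ.setOf_posCode_eq hr]
  exact congrArg (Prod.mk _)
    (γ.value_funCode (fun q => γ.aut.stepPStar {(q, γ.aut.colorOf q)} w) x.1).symm

lemma mem_positionSets {D : List PosCode} : D ∈ γ.positionSets ↔ D ∈ Set.range γ.setCode := by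
  rw [positionSets, List.mem_sublists']
  constructor
  · exact fun h => ⟨{x | γ.posCode x ∈ D},
      (γ.filter_positions_eq_setCode fun x => decide_eq_true_iff).symm.trans
        (eq_filter_of_sublist γ.nodup_positions h).symm⟩
  · rintro ⟨X, rfl⟩
    exact List.filter_sublist

lemma setCode_eq_nil {X : Set γ.aut.Pos} : γ.setCode X = [] ↔ X = ∅ := by
  simp only [List.eq_nil_iff_forall_not_mem, mem_setCode]
  rw [← Set.eq_empty_iff_forall_notMem, Set.image_eq_empty]

lemma mem_behaviorList {c : BehaviorCode} :
    c ∈ γ.behaviorList ↔ c ∈ γ.behaviorCode '' γ.aut.behaviors γ.k := by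
  simp only [behaviorList, List.mem_dedup, List.mem_flatMap, mem_positionSets]
  constructor
  · rintro ⟨_, ⟨D, rfl⟩, h⟩
    rcases D.eq_empty_or_nonempty with rfl | hD
    · simp [γ.setCode_eq_nil.2 rfl] at h
    · rw [beq_eq_false_iff_ne.2 (mt γ.setCode_eq_nil.1 hD.ne_empty), cond_false] at h
      obtain ⟨_, hf, rfl⟩ := List.mem_map.1 h
      obtain ⟨w, hw, rfl⟩ := γ.mem_layer.1 hf
      exact ⟨_, ⟨w, D, hw, hD, rfl⟩, γ.behaviorCode_behavior D w⟩
  · rintro ⟨_, ⟨w, D, hw, hD, rfl⟩, rfl⟩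
    refine ⟨_, ⟨D, rfl⟩, ?_⟩
    rw [beq_eq_false_iff_ne.2 (mt γ.setCode_eq_nil.1 hD.ne_empty), cond_false]
    exact List.mem_map.2 ⟨_, γ.mem_layer.2 ⟨w, hw, rfl⟩, (γ.behaviorCode_behavior D w).symm⟩

lemma nodup_behaviorList : γ.behaviorList.Nodup := List.nodup_dedup _

/-- The code of a vertex. -/
noncomputable def vertexCode : γ.aut.Vertex γ.k → VertexCode
  | .start => .start
  | .pair r x => .pair (γ.behaviorCode r) (γ.posCode x)
  | .fn r => .fn (γ.behaviorCode r)

lemma vertexCode_injective : Function.Injective γ.vertexCode := by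
  intro v v' h
  cases v <;> cases v' <;> simp only [vertexCode, Prod.mk.injEq, reduceCtorEq, and_false, and_true,
    false_and, true_and] at h ⊢
  case pair.pair => rw [Subtype.ext (γ.behaviorCode_injective h.1), γ.posCode_injective h.2]
  case fn.fn => rw [Subtype.ext (γ.behaviorCode_injective h)]

lemma mem_vertexList {c : VertexCode} : c ∈ γ.vertexList ↔ c ∈ Set.range γ.vertexCode := by
  simp only [vertexList, List.mem_cons, List.mem_append, List.mem_map, List.mem_flatMap,
    mem_behaviorList, mem_positions]
  constructor
  · rintro (rfl | ⟨_, ⟨r, hr, rfl⟩, rfl⟩ | ⟨_, ⟨r, hr, rfl⟩, _, ⟨x, rfl⟩, rfl⟩)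
    · exact ⟨.start, rfl⟩
    · exact ⟨.fn ⟨r, hr⟩, rfl⟩
    · exact ⟨.pair ⟨r, hr⟩ x, rfl⟩
  · rintro ⟨_ | ⟨r, x⟩ | r, rfl⟩
    · exact .inl rfl
    · exact .inr (.inr ⟨_, ⟨r.1, r.2, rfl⟩, _, ⟨x, rfl⟩, rfl⟩)
    · exact .inr (.inl ⟨_, ⟨r.1, r.2, rfl⟩, rfl⟩)

lemma nodup_vertexList : γ.vertexList.Nodup := by
  rw [vertexList, List.nodup_cons, List.nodup_append]
  refine ⟨by simp, γ.nodup_behaviorList.map fun _ _ h => by simpa using h, ?_, ?_⟩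
  · rw [List.nodup_flatMap]
    refine ⟨fun r _ => γ.nodup_positions.map fun _ _ h => by simpa using h,
      γ.nodup_behaviorList.imp fun hne => ?_⟩
    simp only [Function.onFun, List.disjoint_left, List.mem_map]
    rintro _ ⟨x, _, rfl⟩ ⟨y, _, h⟩
    simp only [Prod.mk.injEq] at h
    exact hne h.2.1.symm
  · simp only [List.mem_map, List.mem_flatMap]
    rintro _ ⟨r, _, rfl⟩ _ ⟨r', _, x, _, rfl⟩ h
    simp at h

lemma vertexColor_vertexCode (v : γ.aut.Vertex γ.k) :
    γ.vertexColor (γ.vertexCode v) = (γ.aut.arena γ.k).color v := by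
  cases v with
  | pair => rfl
  | start => exact γ.minColor_eq
  | fn => exact γ.minColor_eq

lemma owner_vertexCode (v : γ.aut.Vertex γ.k) :
    (γ.vertexCode v).1.1 = true ↔ (γ.aut.arena γ.k).owner v = .O := by
  cases v <;> simp [vertexCode, DPA.arena]

lemma edge_vertexCode (v v' : γ.aut.Vertex γ.k) :
    γ.edge (γ.vertexCode v) (γ.vertexCode v') = true ↔ (γ.aut.arena γ.k).edge v v' := by
  cases v <;> cases v' <;> simp only [vertexCode, edge, DPA.arena, map_fst_behaviorCode,
    Bool.not_true, Bool.not_false, Bool.true_and, Bool.and_false, Bool.false_and, Bool.or_false,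
    Bool.false_or, cond_true, cond_false, Bool.false_eq_true]
  case start.fn r => rw [beq_iff_eq, initState, initSet_eq, γ.setCode_injective.eq_iff]
  case pair.fn r x r' =>
    rw [← posCode_setCode_mem_behaviorCode, List.any_eq_true]
    simp only [Bool.and_eq_true, beq_iff_eq, ← Prod.mk.injEq, exists_eq_right]
  case fn.pair r r' x =>
    simp only [Bool.and_eq_true, beq_iff_eq, γ.behaviorCode_injective.eq_iff, Subtype.ext_iff]
    refine and_congr_right fun _ => ?_
    rw [← posCode_mem_setCode, ← map_fst_behaviorCode]
    simp

end Input

/-! ### Running time of the algorithm -/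

namespace Input

variable (γ : Input)

lemma n_pos : 0 < γ.n := γ.aut.init.pos

lemma length_colors_le : γ.colors.length ≤ γ.n := by
  have := (List.dedup_sublist γ.colorTable).length_le
  simpa [colors, colorTable] using this

lemma length_positions_le : γ.positions.length ≤ γ.n ^ 2 := by
  have h : γ.positions.length = γ.n * γ.colors.length := by
    simp [positions, stateColors_eq, List.length_flatMap, Function.comp_def, List.ofFn_const]
  rw [h, sq]
  exact Nat.mul_le_mul_left _ γ.length_colors_le

lemma numColors_le : γ.aut.numColors ≤ γ.n := by
  simpa [DPA.numColors, Set.ncard_univ] using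
    Set.ncard_image_le (f := γ.aut.color) Set.finite_univ

lemma length_layer_le (j : ℕ) : (γ.layer j).length ≤ 2 ^ γ.n ^ 3 := by
  classical
  have hsub : (γ.layer j).toFinset ⊆ Finset.univ.image γ.funCode := fun f hf => by
    obtain ⟨w, _, rfl⟩ := γ.mem_layer.1 (List.mem_toFinset.1 hf)
    exact Finset.mem_image_of_mem _ (Finset.mem_univ _)
  have hcol : Fintype.card γ.aut.Col ≤ γ.n := by simpa using Fintype.card_range_le γ.aut.color
  calc (γ.layer j).length = (γ.layer j).toFinset.card :=
        (List.toFinset_card_of_nodup (γ.nodup_layer j)).symm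
    _ ≤ Fintype.card (Fin γ.n → Set γ.aut.Pos) :=
        (Finset.card_le_card hsub).trans Finset.card_image_le
    _ = 2 ^ (γ.n * Fintype.card γ.aut.Col * γ.n) := by
        simp only [Fintype.card_fun, Fintype.card_set, Fintype.card_prod, Fintype.card_fin, pow_mul]
    _ ≤ 2 ^ (γ.n * γ.n * γ.n) := by gcongr; norm_num
    _ = 2 ^ γ.n ^ 3 := by ring_nf

lemma length_behaviorList_le : γ.behaviorList.length ≤ 2 ^ (2 * γ.n ^ 3) := by
  have hlen : γ.behaviorList.length ≤ γ.positionSets.length * (γ.layer γ.k).length := by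
    refine (List.dedup_sublist _).length_le.trans ?_
    rw [List.length_flatMap]
    refine (List.sum_le_card_nsmul _ (γ.layer γ.k).length ?_).trans (by simp)
    simp only [List.mem_map]
    rintro _ ⟨D, _, rfl⟩
    cases D == [] <;> simp
  have hsets : γ.positionSets.length ≤ 2 ^ γ.n ^ 2 := by
    rw [positionSets, List.length_sublists']
    exact Nat.pow_le_pow_right two_pos γ.length_positions_le
  calc γ.behaviorList.length ≤ 2 ^ γ.n ^ 2 * 2 ^ γ.n ^ 3 :=
        hlen.trans (Nat.mul_le_mul hsets (γ.length_layer_le γ.k))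
    _ ≤ 2 ^ γ.n ^ 3 * 2 ^ γ.n ^ 3 := by
        gcongr
        exacts [one_le_two, γ.n_pos, Nat.le_succ 2]
    _ = 2 ^ (2 * γ.n ^ 3) := by ring

lemma length_vertexList_pos : 0 < γ.vertexList.length := Nat.succ_pos _

lemma length_vertexList_le : γ.vertexList.length ≤ 2 ^ (4 * γ.n ^ 3) := by
  have hlen : γ.vertexList.length =
      γ.behaviorList.length + γ.behaviorList.length * γ.positions.length + 1 := by
    simp [vertexList, List.length_flatMap]
  have hbeh := γ.length_behaviorList_le
  have hpos : γ.positions.length < 2 ^ γ.n ^ 3 :=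
    (γ.length_positions_le.trans (Nat.pow_le_pow_right γ.n_pos (Nat.le_succ 2))).trans_lt
      Nat.lt_two_pow_self
  have hone : 1 ≤ 2 ^ (2 * γ.n ^ 3) := Nat.one_le_two_pow
  have htwo : 2 ≤ 2 ^ γ.n ^ 3 := Nat.le_self_pow (Nat.pow_pos γ.n_pos).ne' 2
  calc γ.vertexList.length ≤ 2 ^ (2 * γ.n ^ 3) * (2 ^ γ.n ^ 3 * 2) := by
        rw [hlen]
        nlinarith [Nat.mul_le_mul hbeh hpos.le]
    _ ≤ 2 ^ (2 * γ.n ^ 3) * (2 ^ γ.n ^ 3 * 2 ^ γ.n ^ 3) := by gcongr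
    _ = 2 ^ (4 * γ.n ^ 3) := by ring

lemma weight_layer_le (j : ℕ) : weight (γ.layer j) ≤
    2 + 2 ^ γ.n ^ 3 * (2 + γ.n * (4 * γ.n + 2 + weight γ.positions)) := by
  refine weight_list_le (γ.length_layer_le j) fun f hf => ?_
  obtain ⟨w, _, rfl⟩ := γ.mem_layer.1 hf
  refine weight_list_le (by simp [wordCode, funCode]) fun p hp => ?_
  obtain ⟨q, -, rfl⟩ := List.mem_map.1 hp
  have hq : weight (q : ℕ) ≤ 4 * γ.n + 2 := (weight_nat_le q).trans (by omega)
  exact Nat.add_le_add hq (weight_le_of_sublist List.filter_sublist)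

lemma length_instructions_le (cs : List ℕ) :
    (γ.instructions cs).length ≤ (3 * γ.vertexList.length) ^ cs.length := by
  have hpos := γ.length_vertexList_pos
  induction cs with
  | nil => simp [instructions]
  | cons c cs ih =>
    have hlen : (γ.instructions (c :: cs)).length =
        γ.vertexList.length * ((γ.instructions cs).length + 1) + 1 := by
      simp [instructions, List.length_flatMap]
    rw [hlen, List.length_cons, pow_succ]
    have hone : 1 ≤ (3 * γ.vertexList.length) ^ cs.length := Nat.one_le_pow _ _ (by omega)
    nlinarith [Nat.mul_le_mul_left γ.vertexList.length ih,
      Nat.mul_le_mul_left γ.vertexList.length hone]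

lemma length_instructions_le_of_length_le {cs : List ℕ} (h : cs.length ≤ γ.n) :
    (γ.instructions cs).length ≤ (2 ^ γ.n ^ 4) ^ 6 :=
  calc (γ.instructions cs).length ≤ (3 * γ.vertexList.length) ^ γ.n :=
        (γ.length_instructions_le cs).trans
          (Nat.pow_le_pow_right (Nat.mul_pos three_pos γ.length_vertexList_pos) h)
    _ ≤ (2 ^ (2 * γ.n ^ 3) * 2 ^ (4 * γ.n ^ 3)) ^ γ.n := by
        gcongr
        · have : 1 ≤ γ.n ^ 3 := Nat.pow_pos γ.n_pos
          calc 3 ≤ 2 ^ (2 * 1) := by norm_num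
            _ ≤ 2 ^ (2 * γ.n ^ 3) := by gcongr; norm_num
        · exact γ.length_vertexList_le
    _ = (2 ^ γ.n ^ 4) ^ 6 := by ring

lemma instructions_cons (c : ℕ) (cs : List ℕ) : γ.instructions (c :: cs) =
    .reset c :: γ.vertexList.flatMap fun _ => γ.instructions cs ++ [.assign c] := rfl

lemma snd_eq_zero_or_mem_of_mem_instructions {cs : List ℕ} {i : Instruction}
    (h : i ∈ γ.instructions cs) : i.2 = 0 ∨ i.2 ∈ cs := by
  induction cs with
  | nil => exact .inl (by rw [List.mem_singleton.1 h])
  | cons c cs ih =>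
    simp only [instructions_cons, List.mem_cons, List.mem_flatMap, List.mem_append,
      List.not_mem_nil, or_false] at h
    rcases h with rfl | ⟨_, _, h | rfl⟩
    · exact .inr List.mem_cons_self
    · exact (ih h).imp_right (List.mem_cons_of_mem _)
    · exact .inr List.mem_cons_self

lemma weight_instructions_le {cs : List ℕ} (h : cs.IsSuffix γ.colors) :
    weight (γ.instructions cs) ≤ 2 + (2 ^ γ.n ^ 4) ^ 6 * (10 + weight γ.colors) := by
  refine weight_list_le (γ.length_instructions_le_of_length_le
    (h.length_le.trans γ.length_colors_le)) fun i hi => ?_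
  have hcolor : weight i.2 ≤ 2 + weight γ.colors := by
    rcases γ.snd_eq_zero_or_mem_of_mem_instructions hi with hi | hi
    · rw [hi]
      exact Nat.le_add_right _ _
    · exact (weight_le_of_mem (h.subset hi)).trans (Nat.le_add_left _ _)
  have htag := weight_bool_le i.1.1
  have htag' := weight_bool_le i.1.2
  calc weight i = weight i.1.1 + weight i.1.2 + weight i.2 := by rw [← weight_prod, ← weight_prod]
    _ ≤ 10 + weight γ.colors := by omega

lemma foldl_exec_sublist (l : List Instruction) {st : FamilyCode × List VertexCode}
    (h₁ : st.1.Sublist γ.coloredVertices) (h₂ : st.2.Sublist γ.vertexList) :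
    (l.foldl γ.exec st).1.Sublist γ.coloredVertices ∧
      (l.foldl γ.exec st).2.Sublist γ.vertexList := by
  induction l generalizing st with
  | nil => exact ⟨h₁, h₂⟩
  | cons i _ ih =>
    refine ih ?_ ?_ <;> unfold exec <;> cases i.1.1
    exacts [h₁, List.filter_sublist, List.filter_sublist, h₂]

end Input

lemma PolyBounded.two_pow : PolyBounded fun γ : Input => 2 ^ γ.n ^ 4 :=
  PolyBounded.weight_self.mono fun γ => Nat.le_add_left _ ((encodeInput γ.aut γ.k).size + 1)

lemma PolyBounded.two_pow_cube : PolyBounded fun γ : Input => 2 ^ γ.n ^ 3 :=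
  PolyBounded.two_pow.mono fun γ =>
    Nat.pow_le_pow_right two_pos (Nat.pow_le_pow_right γ.n_pos (Nat.le_succ 3))

lemma PolyBounded.exponent : PolyBounded Input.k :=
  (PolyBounded.two_pow_cube.pow 2).mono fun γ =>
    calc γ.k ≤ 2 ^ (γ.n ^ 2 * γ.aut.numColors + 1) := γ.k_le
      _ ≤ 2 ^ (γ.n ^ 2 * γ.n + γ.n ^ 3) := by
        gcongr
        exacts [one_le_two, γ.numColors_le, Nat.pow_pos γ.n_pos]
      _ = (2 ^ γ.n ^ 3) ^ 2 := by ring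

lemma PolyBounded.card_states : PolyBounded Input.n :=
  PolyBounded.two_pow.mono fun γ =>
    (Nat.le_self_pow four_ne_zero γ.n).trans Nat.lt_two_pow_self.le

namespace PolyTime

@[fun_prop] lemma layer : PolyTime fun γ : Input => γ.layer γ.k := by
  unfold Input.layer
  have hn := PolyBounded.card_states
  have hpow := PolyBounded.two_pow_cube
  have hpos := positions.polyBounded
  refine foldl (g := fun γ L _ => Input.stepLayer γ L) (by fun_prop) (by fun_prop)
    (.replicate exponent .exponent)
    (W := fun γ => 2 + 2 ^ γ.n ^ 3 * (2 + γ.n * (4 * γ.n + 2 + weight γ.positions)))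
    (by fun_prop) fun γ l _ => ?_
  have hl : l = List.replicate l.length () := List.eq_replicate_iff.2 ⟨rfl, fun _ _ => rfl⟩
  rw [hl]
  exact γ.weight_layer_le l.length

@[fun_prop] lemma positionSets : PolyTime Input.positionSets :=
  sublists' positions <| PolyBounded.two_pow_cube.mono fun γ =>
    Nat.pow_le_pow_right two_pos <|
      γ.length_positions_le.trans (Nat.pow_le_pow_right γ.n_pos (Nat.le_succ 2))

@[fun_prop] lemma behaviorList : PolyTime Input.behaviorList := by
  unfold Input.behaviorList
  have hlayer : PolyTime fun p : Input × List PosCode => p.1.layer p.1.k := layer.comp fst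
  fun_prop

@[fun_prop] lemma vertexList : PolyTime Input.vertexList := by unfold Input.vertexList; fun_prop

@[fun_prop] lemma coloredVertices : PolyTime Input.coloredVertices := by
  unfold Input.coloredVertices; fun_prop

@[fun_prop] lemma instructions_colors : PolyTime fun γ : Input => γ.instructions γ.colors := by
  unfold Input.instructions
  have hpow := PolyBounded.two_pow
  have hcol := colors.polyBounded
  exact foldr (g := fun (γ : Input) c I =>
      Instruction.reset c :: γ.vertexList.flatMap fun _ => I ++ [Instruction.assign c])
    (by fun_prop) (by fun_prop) (by fun_prop)
    (W := fun γ => 2 + (2 ^ γ.n ^ 4) ^ 6 * (10 + weight γ.colors))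
    (by fun_prop) fun γ l h => γ.weight_instructions_le h

variable {α : Type*} [TreeEncoding α] {γ : α → Input}

@[fun_prop] lemma edge {v v' : α → VertexCode}
    (hγ : PolyTime γ) (hv : PolyTime v) (hv' : PolyTime v') :
    PolyTime fun a => (γ a).edge (v a) (v' a) := by
  unfold Input.edge; fun_prop

@[fun_prop] lemma vertexColor {v : α → VertexCode} (hγ : PolyTime γ) (hv : PolyTime v) :
    PolyTime fun a => (γ a).vertexColor (v a) := by
  unfold Input.vertexColor; fun_prop

@[fun_prop] lemma canForce {Z : α → FamilyCode} {v : α → VertexCode}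
    (hγ : PolyTime γ) (hZ : PolyTime Z) (hv : PolyTime v) :
    PolyTime fun a => (γ a).canForce (Z a) (v a) := by
  unfold Input.canForce; fun_prop

@[fun_prop] lemma exec {st : α → FamilyCode × List VertexCode} {i : α → Instruction}
    (hγ : PolyTime γ) (hst : PolyTime st) (hi : PolyTime i) :
    PolyTime fun a => (γ a).exec (st a) (i a) := by
  unfold Input.exec; fun_prop

@[fun_prop] lemma winRegion : PolyTime Input.winRegion := by
  unfold Input.winRegion
  refine snd.comp (foldl (g := fun γ st i => Input.exec γ st i) (by fun_prop) (by fun_prop)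
    (by fun_prop) (coloredVertices.polyBounded.add vertexList.polyBounded) fun γ l _ => ?_)
  obtain ⟨h₁, h₂⟩ :=
    γ.foldl_exec_sublist l (st := ([], [])) (List.nil_sublist _) (List.nil_sublist _)
  exact Nat.add_le_add (weight_le_of_sublist h₁) (weight_le_of_sublist h₂)

lemma output : PolyTime Input.output := by
  unfold Input.output Input.winnerIsO; fun_prop

end PolyTime

/-! ### Correctness of the fixpoint computation -/

lemma foldl_flatMap_const {β δ ε : Type*} (f : δ → ε → δ) (l : List β) (K : List ε) (st : δ) :
    (l.flatMap fun _ => K).foldl f st = (fun st => K.foldl f st)^[l.length] st := by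
  induction l generalizing st with
  | nil => rfl
  | cons x l ih => rw [List.flatMap_cons, List.foldl_append, ih]; rfl

namespace Input

open ParityGame

variable (γ : Input)

/-- A state of the computation represents the family `Z` of sets of vertices, of which only the
members for the colors of the automaton matter, and the result `X`. -/
structure Represents (st : FamilyCode × List VertexCode) (Z : ℕ → Set (γ.aut.Vertex γ.k))
    (X : Set (γ.aut.Vertex γ.k)) : Prop where
  family : ∀ c ∈ γ.colors, ∀ v, (c, γ.vertexCode v) ∈ st.1 ↔ v ∈ Z c
  result : ∀ v, γ.vertexCode v ∈ st.2 ↔ v ∈ X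

lemma color_mem_colors (v : γ.aut.Vertex γ.k) : (γ.aut.arena γ.k).color v ∈ γ.colors := by
  rw [mem_colors]
  cases v with
  | pair r x => exact x.2.2
  | _ => exact Nat.sInf_mem ⟨_, γ.aut.init, rfl⟩

variable {γ}

lemma mem_coloredVertices {c : ℕ} {v : γ.aut.Vertex γ.k} :
    (c, γ.vertexCode v) ∈ γ.coloredVertices ↔ c ∈ γ.colors := by
  have hv : γ.vertexCode v ∈ γ.vertexList := γ.mem_vertexList.2 ⟨v, rfl⟩
  simp [coloredVertices, hv]

namespace Represents

variable {st : FamilyCode × List VertexCode} {Z : ℕ → Set (γ.aut.Vertex γ.k)}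
  {X : Set (γ.aut.Vertex γ.k)}

lemma canForce (h : γ.Represents st Z X) (v : γ.aut.Vertex γ.k) :
    γ.canForce st.1 (γ.vertexCode v) = true ↔
      v ∈ (γ.aut.arena γ.k).pre .O (Z ((γ.aut.arena γ.k).color v)) := by
  have hZ := h.family _ (γ.color_mem_colors v)
  simp only [Input.canForce, pre, Set.mem_ofPred_eq, ne_eq, ← γ.owner_vertexCode v,
    vertexColor_vertexCode, List.any_beq', List.contains_eq_mem]
  cases (γ.vertexCode v).1.1
  · simp only [cond_false, List.all_eq_true, mem_vertexList, Set.forall_mem_range,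
      Bool.or_eq_true, Bool.not_eq_true', ← Bool.not_eq_true, edge_vertexCode, decide_eq_true_iff,
      hZ]
    simp [imp_iff_not_or]
  · simp only [cond_true, List.any_eq_true, mem_vertexList, Set.exists_range_iff,
      Bool.and_eq_true, edge_vertexCode, decide_eq_true_iff, hZ]
    simp

lemma compute (h : γ.Represents st Z X) (N : ℕ) :
    γ.Represents (γ.exec st .compute) Z ((γ.aut.arena γ.k).solve .O N [] Z) where
  family := h.family
  result v := by
    simp only [exec, cond_false, List.mem_filter, h.canForce]
    exact and_iff_right (γ.mem_vertexList.2 ⟨v, rfl⟩)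

lemma assign (h : γ.Represents st Z X) (i : ℕ) :
    γ.Represents (γ.exec st (.assign i)) (Function.update Z i X) X where
  family c hc v := by
    simp only [exec, cond_true, cond_false, List.mem_filter, mem_coloredVertices, hc, true_and]
    obtain rfl | hci := eq_or_ne c i
    · simp [h.result]
    · rw [beq_eq_false_iff_ne.2 hci, Function.update_of_ne hci]
      simp [h.family c hc]
  result := h.result

lemma reset (h : γ.Represents st Z X) (i : ℕ) :
    γ.Represents (γ.exec st (.reset i)) (Function.update Z i {_v | Good .O i}) X where
  family c hc v := by
    simp only [exec, cond_true, List.mem_filter, mem_coloredVertices, hc, true_and]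
    obtain rfl | hci := eq_or_ne c i
    · have hbodd : c.bodd = false ↔ Even c := by
        rw [Nat.even_iff, Nat.mod_two_of_bodd]; cases c.bodd <;> simp
      simp [Good, hbodd]
    · rw [beq_eq_false_iff_ne.2 hci, Function.update_of_ne hci]
      simp [h.family c hc]
  result := h.result

end Represents

variable (γ)

/-- The instructions for the colors in `cs` compute the nested fixpoint for these colors and do not
affect the sets for other colors. -/
def InstructionsCorrect (cs : List ℕ) : Prop :=
  ∀ st Z X, γ.Represents st Z X → ∃ Z', γ.Represents ((γ.instructions cs).foldl γ.exec st) Z'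
    ((γ.aut.arena γ.k).solve .O γ.vertexList.length cs Z) ∧ ∀ c ∉ cs, Z' c = Z c

variable {γ} {cs : List ℕ} {i : ℕ} {st : FamilyCode × List VertexCode}
  {Z Z₁ : ℕ → Set (γ.aut.Vertex γ.k)} {X₁ : Set (γ.aut.Vertex γ.k)}

namespace InstructionsCorrect

lemma step (hcs : γ.InstructionsCorrect cs) (h : γ.Represents st Z₁ X₁)
    (hZ₁ : ∀ c ∉ i :: cs, Z₁ c = Z c) :
    ∃ Z₂, γ.Represents ((γ.instructions cs ++ [Instruction.assign i]).foldl γ.exec st) Z₂ (Z₂ i) ∧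
      Z₂ i = (γ.aut.arena γ.k).solve .O γ.vertexList.length cs (Function.update Z i (Z₁ i)) ∧
      ∀ c ∉ i :: cs, Z₂ c = Z c := by
  obtain ⟨Z', hrep, hZ'⟩ := hcs st Z₁ X₁ h
  refine ⟨Function.update Z' i ((γ.aut.arena γ.k).solve .O γ.vertexList.length cs Z₁), ?_, ?_,
    fun c hc => ?_⟩
  · rw [List.foldl_append]
    simpa only [Function.update_self, List.foldl_cons, List.foldl_nil] using hrep.assign i
  · rw [Function.update_self]
    refine solve_congr fun c hc => ?_
    obtain rfl | hci := eq_or_ne c i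
    · rw [Function.update_self]
    · rw [Function.update_of_ne hci, hZ₁ c (by simp [hc, hci])]
  · have hne := List.ne_of_not_mem_cons hc
    rw [Function.update_of_ne hne, hZ' c (List.not_mem_of_not_mem_cons hc), hZ₁ c hc]

lemma iterate (hcs : γ.InstructionsCorrect cs) (h : γ.Represents st Z₁ X₁)
    (hZ₁ : ∀ c ∉ i :: cs, Z₁ c = Z c) (j : ℕ) :
    ∃ Z₂, γ.Represents
        ((fun st => (γ.instructions cs ++ [Instruction.assign i]).foldl γ.exec st)^[j + 1] st)
        Z₂ (Z₂ i) ∧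
      Z₂ i = (fun Y => (γ.aut.arena γ.k).solve .O γ.vertexList.length cs
        (Function.update Z i Y))^[j + 1] (Z₁ i) ∧
      ∀ c ∉ i :: cs, Z₂ c = Z c := by
  induction j with
  | zero => exact hcs.step h hZ₁
  | succ j ih =>
    obtain ⟨Z₂, hrep, hi, hZ₂⟩ := ih
    rw [Function.iterate_succ_apply', Function.iterate_succ_apply' (n := j + 1), ← hi]
    exact hcs.step hrep hZ₂

end InstructionsCorrect

variable (γ)

lemma instructionsCorrect (cs : List ℕ) : γ.InstructionsCorrect cs := by
  induction cs with
  | nil => exact fun st Z X h => ⟨Z, h.compute _, fun _ _ => rfl⟩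
  | cons i cs ih =>
    intro st Z X h
    obtain ⟨j, hj⟩ := Nat.exists_eq_succ_of_ne_zero γ.length_vertexList_pos.ne'
    obtain ⟨Z', hrep, hi, hZ'⟩ := ih.iterate (h.reset i)
      (fun c hc => Function.update_of_ne (List.ne_of_not_mem_cons hc) _ _) j
    refine ⟨Z', ?_, hZ'⟩
    rw [hi, Function.update_self] at hrep
    rw [instructions_cons, List.foldl_cons, foldl_flatMap_const, solve, hj]
    rwa [hj] at hrep

lemma winnerIsO_iff : γ.winnerIsO = true ↔
    .start ∈ (γ.aut.arena γ.k).solve .O γ.vertexList.length γ.colors fun _ => ∅ := by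
  obtain ⟨_, hrep, -⟩ := γ.instructionsCorrect γ.colors ([], []) (fun _ => ∅) ∅
    ⟨by simp, by simp⟩
  rw [← hrep.result, winnerIsO, winRegion, List.any_eq_true]
  simp only [beq_iff_eq, exists_eq_right]
  rfl

end Input

/-! ### The output -/

/-- The parity game on `V` that corresponds to `H` under a bijection of the vertices. -/
def ParityGame.comap {V W : Type*} (H : ParityGame W) (e : V ≃ W) : ParityGame V where
  owner v := H.owner (e v)
  edge v v' := H.edge (e v) (e v')
  init := e.symm H.init
  color v := H.color (e v)

lemma ParityGame.isIso_comap {V W : Type*} (H : ParityGame W) (e : V ≃ W) :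
    IsIso (H.comap e) H e where
  owner _ := rfl
  edge _ _ := Iff.rfl
  init := e.apply_symm_apply _
  color _ := rfl

lemma encodeList_ofFn {α β δ : Type*} [TreeEncoding δ] {l : List α} {f : β → Tree}
    {g : Fin l.length → β} {F : α → δ} (h : ∀ i, f (g i) = enc (F l[i])) :
    encodeList f (List.ofFn g) = enc (l.map F) := by
  induction l with
  | nil => rfl
  | cons x l ih =>
    rw [List.ofFn_succ]
    exact congrArg₂ Tree.node (h 0) (ih fun i => h i.succ)

namespace Input

open ParityGame

variable (γ : Input)

open Classical in
/-- The numbering of the vertices of the arena. -/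
noncomputable def vertexEquiv : Fin γ.vertexList.length ≃ γ.aut.Vertex γ.k :=
  (γ.nodup_vertexList.getEquiv).trans
    ((Equiv.subtypeEquivRight fun _ => γ.mem_vertexList).trans
      (Equiv.ofInjective _ γ.vertexCode_injective).symm)

/-- The parity game in the output of the algorithm. -/
noncomputable def game : ParityGame (Fin γ.vertexList.length) :=
  (γ.aut.arena γ.k).comap γ.vertexEquiv

/-- The player in the output of the algorithm. -/
def winner : Player := if γ.winnerIsO then .O else .I

lemma vertexCode_vertexEquiv (i : Fin γ.vertexList.length) :
    γ.vertexCode (γ.vertexEquiv i) = γ.vertexList[i] :=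
  Equiv.apply_ofInjective_symm γ.vertexCode_injective _

lemma coe_init_game : (γ.game.init : ℕ) = 0 := by
  have h : γ.game.init = ⟨0, γ.length_vertexList_pos⟩ := by
    refine (Equiv.symm_apply_eq _).2 (γ.vertexCode_injective ?_)
    rw [vertexCode_vertexEquiv]
    rfl
  rw [h]

lemma encodeOutput_game : encodeOutput γ.game γ.winner = enc γ.output := by
  have hwinner : encodePlayer γ.winner = encodeBool γ.winnerIsO := by
    rw [winner]; cases γ.winnerIsO <;> rfl
  have howner : encodeList encodePlayer (List.ofFn γ.game.owner) =
      enc (γ.vertexList.map fun v => v.1.1) := encodeList_ofFn fun i => by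
    rw [← vertexCode_vertexEquiv]
    change encodePlayer ((γ.aut.arena γ.k).owner (γ.vertexEquiv i)) = _
    cases γ.vertexEquiv i <;> rfl
  have hcolor : encodeList encodeNat (List.ofFn γ.game.color) =
      enc (γ.vertexList.map γ.vertexColor) := encodeList_ofFn fun i => by
    rw [← vertexCode_vertexEquiv, vertexColor_vertexCode]
    rfl
  classical
  have hedge : encodeList (encodeList encodeBool)
      (List.ofFn fun i => List.ofFn fun j => decide (γ.game.edge i j)) =
      enc (γ.vertexList.map fun v => γ.vertexList.map fun v' => γ.edge v v') :=
    encodeList_ofFn fun i => encodeList_ofFn fun j => by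
      rw [← vertexCode_vertexEquiv, ← vertexCode_vertexEquiv]
      refine congrArg encodeBool ?_
      rw [Bool.eq_iff_iff, decide_eq_true_iff, edge_vertexCode]
      rfl
  simp only [encodeOutput, encodeGame, hwinner, coe_init_game, howner, hcolor, hedge]
  rfl

lemma exists_posWins_winner :
    ∃ W g, (γ.aut.arena γ.k).PosWins γ.winner W g ∧ .start ∈ W := by
  have : Finite (γ.aut.Vertex γ.k) := .of_equiv _ γ.vertexEquiv
  have hcard : Nat.card (γ.aut.Vertex γ.k) ≤ γ.vertexList.length := by
    rw [← Nat.card_congr γ.vertexEquiv, Nat.card_fin]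
  rw [winner]
  split_ifs with hO
  · obtain ⟨g, hg⟩ := exists_posWins .O hcard γ.pairwise_colors γ.color_mem_colors fun _ => ∅
    exact ⟨_, g, hg, γ.winnerIsO_iff.1 hO⟩
  · obtain ⟨g, hg⟩ := exists_posWins .I hcard γ.pairwise_colors γ.color_mem_colors fun _ => ∅ᶜ
    refine ⟨_, g, hg, ?_⟩
    have hcompl := compl_solve (G := γ.aut.arena γ.k) .O γ.vertexList.length γ.colors fun _ => ∅
    exact hcompl ▸ fun hstart => hO (γ.winnerIsO_iff.2 hstart)

lemma wins_game_iff (p : Player) : γ.game.Wins p ↔ p = γ.winner := by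
  obtain ⟨W, g, hg, hstart⟩ := γ.exists_posWins_winner
  have he := (γ.aut.arena γ.k).isIso_comap γ.vertexEquiv
  have hwinner : γ.game.Wins γ.winner :=
    (hg.comap he).wins (by rw [Set.mem_preimage, he.init]; exact hstart)
  refine ⟨fun hp => ?_, fun hp => hp ▸ hwinner⟩
  by_contra hne
  refine not_forall_wins γ.game fun q => ?_
  obtain rfl | rfl : q = p ∨ q = γ.winner := by
    generalize γ.winner = r at hne
    cases p <;> cases q <;> cases r <;> simp at hne ⊢
  exacts [hp, hwinner]

lemma oWins_iff : γ.aut.OWins γ.k ↔ γ.winner = .O := by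
  obtain ⟨W, g, hg, hstart⟩ := γ.exists_posWins_winner
  cases hw : γ.winner <;> rw [hw] at hg
  · exact iff_of_false (DPA.not_oWins_of_posWins hg hstart) (by simp)
  · exact iff_of_true (DPA.oWins_of_posWins hg hstart) rfl

lemma weight_le : weight γ ≤ 2 ^ (3 * γ.n ^ 4) * (enc γ).size := by
  have hsize := (enc γ).size_pos
  have hpow : 2 ≤ 2 ^ γ.n ^ 4 := Nat.le_self_pow (pow_pos γ.n_pos 4).ne' 2
  calc weight γ
    _ = (enc γ).size + 1 + 2 ^ γ.n ^ 4 := rfl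
    _ ≤ 2 * 2 * 2 ^ γ.n ^ 4 * (enc γ).size := by nlinarith
    _ ≤ 2 ^ γ.n ^ 4 * 2 ^ γ.n ^ 4 * 2 ^ γ.n ^ 4 * (enc γ).size := by gcongr
    _ = 2 ^ (3 * γ.n ^ 4) * (enc γ).size := by rw [← pow_add, ← pow_add]; ring_nf

lemma two_pow_mul_le {m i d : ℕ} (hm : m ≤ d) (hi : i ≤ d) :
    2 ^ (m * γ.n ^ i) ≤ 2 ^ (d * γ.n ^ d) :=
  Nat.pow_le_pow_right two_pos (Nat.mul_le_mul hm (Nat.pow_le_pow_right γ.n_pos hi))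

end Input

lemma PolyBounded.exists_le_two_pow_mul {T : Input → ℕ} (hT : PolyBounded T) :
    ∃ d ≥ 4, ∀ γ, T γ ≤ 2 ^ (d * γ.n ^ d) * (enc γ).size ^ d := by
  obtain ⟨c, hc⟩ := hT
  refine ⟨3 * c + 4, by omega, fun γ => ?_⟩
  calc T γ
    _ ≤ weight γ ^ (c + 1) := (hc γ).trans (weight_pow_le_weight_pow γ c.le_succ)
    _ ≤ (2 ^ (3 * γ.n ^ 4) * (enc γ).size) ^ (c + 1) := Nat.pow_le_pow_left γ.weight_le _
    _ = 2 ^ (3 * (c + 1) * γ.n ^ 4) * (enc γ).size ^ (c + 1) := by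
      rw [mul_pow, ← pow_mul]; ring_nf
    _ ≤ _ := Nat.mul_le_mul (γ.two_pow_mul_le (by omega) (by omega))
      (Nat.pow_le_pow_right (enc γ).size_pos (by omega))

lemma PolyTime.exists_outputs {α β : Type*} [TreeEncoding α] [TreeEncoding β] {f : α → β}
    (hf : PolyTime f) :
    ∃ (P : Program) (T : α → ℕ), PolyBounded T ∧
      ∀ a, ∃ t ≤ T a, P.Outputs (enc a) (enc (f a)) t := by
  obtain ⟨P, e, T, hT, he⟩ := hf.exists_computes
  refine ⟨e.shift 1 :: P.map (Expr.shift 1), T, hT, fun a => ?_⟩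
  obtain ⟨t, ht, h⟩ := he a
  exact ⟨t, ht, e.shift 1, rfl, h.shift fun i b hb => by simp [hb]⟩

end DelayGame

/-- One program and one constant `d` work for all automata with `n` states over finite non-empty
alphabets and all admissible `k`: in time exponential in `n` (and polynomial in the length of the
input) the program outputs `𝒢_k` as a parity game `G` in an arena of size exponential in `n`,
together with the winner `p` of the game. -/
theorem lemma3p3 :
    ∃ (P : DelayGame.Program) (d : ℕ),
      ∀ (n s t k : ℕ) (𝔄 : DelayGame.DPA (Fin n) (Fin s × Fin t)),
        0 < s → 0 < t → 0 < k → k ≤ 2 ^ (n ^ 2 * 𝔄.numColors + 1) →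
        ∃ (N : ℕ) (G : DelayGame.ParityGame (Fin N)) (e : Fin N ≃ 𝔄.Vertex k)
          (p : DelayGame.Player) (T : ℕ),
          P.Outputs (DelayGame.encodeInput 𝔄 k) (DelayGame.encodeOutput G p) T ∧
          T ≤ 2 ^ (d * n ^ d) * (DelayGame.encodeInput 𝔄 k).size ^ d ∧
          G.IsIso (𝔄.arena k) e ∧
          N ≤ 2 ^ (d * n ^ d) ∧
          (∀ p', G.Wins p' ↔ p' = p) ∧
          (𝔄.OWins k ↔ p = DelayGame.Player.O) := by
  obtain ⟨P, T, hT, houtputs⟩ := DelayGame.PolyTime.output.exists_outputs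
  obtain ⟨d, hd, htime⟩ := hT.exists_le_two_pow_mul
  refine ⟨P, d, fun n s t k 𝔄 _ ht _ hle => ?_⟩
  let γ : DelayGame.Input := ⟨n, s, t, k, 𝔄, ht, hle⟩
  obtain ⟨u, hu, hrun⟩ := houtputs γ
  rw [← γ.encodeOutput_game] at hrun
  exact ⟨_, γ.game, γ.vertexEquiv, γ.winner, u, hrun, hu.trans (htime γ),
    (𝔄.arena k).isIso_comap γ.vertexEquiv,
    γ.length_vertexList_le.trans (γ.two_pow_mul_le hd (by omega)), γ.wins_game_iff, γ.oWins_iff⟩
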